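/- Let $\lambda$ be a regular uncountable cardinal, and assume that GCH holds below $\lambda$, i.e. $2^\kappa=\kappa^+$ for every infinite cardinal $\kappa<\lambda$. Let $S\subseteq\lambda$ be fat: for every regular cardinal $\theta<\lambda$ and every club $C$ of $\lambda$, the set $S\cap C$ contains a closed subset of order type $\theta+1$. Let $\mathbb P$ be a notion of forcing (a preordered set, where $p\le q$ means that $q$ extends $p$). $\mathbb P$ is called explicitly $S$-closed if there is a function $\delta\colon\mathbb P\to\lambda$ such that 1. $p\le q$ implies $\delta(p)\le\delta(q)$; 2. for every $\gamma<\lambda$ the set $\{p\in\mathbb P : \delta(p)\ge\gamma\}$ is dense in $\mathbb P$; 3. whenever $\langle p_i\rangle_{i<i^*}$ is a nonempty increasing sequence of conditions such that $\delta(p_i)<\delta(p_j)$ for all $i<j<i^*$, and $\alpha=\sup_{i<i^*}\delta(p_i)\in S$, then the sequence has an upper bound $p^*\in\mathbb P$ with $\delta(p^*)=\alpha$. $\mathbb P$ is called strategically $S$-closed if the completeness player has a winning strategy in the following game of length $\le\lambda$. Two players, incompleteness and completeness, alternate; incompleteness makes the first move, and completeness moves at limit steps. Move number $i$ consists of a condition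 $p_i\in\mathbb P$ and an ordinal $\epsilon_i<\lambda$; the sequence $\langle p_i\rangle$ must be increasing, and $\langle\epsilon_i\rangle$ must be strictly increasing and continuous. At a limit stage $i<\lambda$ let $\epsilon_i=\sup_{j<i}\epsilon_j$: incompleteness loses if $\epsilon_i\notin S$, and completeness loses if $\epsilon_i\in S$ and $\langle p_j\rangle_{j<i}$ has no upper bound in $\mathbb P$. If the play lasts $\lambda$ moves, then completeness wins. **Proposition.** (a) If $\mathbb P$ is explicitly $S$-closed, then $\mathbb P$ is $<\!\lambda$-distributive (the intersection of fewer than $\lambda$ dense open subsets of $\mathbb P$ is dense), and $S$ is fat in $V^{\mathbb P}$ (every condition forces that $\check S$ is a fat subset of $\check\lambda$). (b) The same two conclusions hold if $\mathbb P$ is strategically $S$-closed. -/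

import Mathlib

open Order Cardinal

universe u

/-! ### Combinatorics of subsets of a cardinal

A subset of the cardinal `lam` is a `Set (Set.Iio lam.ord)`, a set of ordinals below `lam.ord`. -/

/-- GCH below `lam`: `2 ^ κ = κ⁺` for every infinite cardinal `κ < lam`. -/
def GCHBelow (lam : Cardinal.{u}) : Prop :=
  ∀ κ : Cardinal.{u}, ℵ₀ ≤ κ → κ < lam → (2 : Cardinal.{u}) ^ κ = succ κ

/-- `S ⊆ lam` is fat: for every regular `θ < lam` and every club `C` of `lam`, the set `S ∩ C`
contains a closed subset of order type `θ + 1` (the order type of `Set.Iic θ.ord`). -/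
def IsFat {lam : Cardinal.{u}} (S : Set (Set.Iio lam.ord)) : Prop :=
  ∀ θ : Cardinal.{u}, θ.IsRegular → θ < lam → ∀ C : Set (Set.Iio lam.ord), IsClub C →
    ∃ D : Set (Set.Iio lam.ord), D ⊆ S ∩ C ∧ DirSupClosed D ∧ Nonempty (Set.Iic θ.ord ≃o D)

/-! ### Notions of forcing

A notion of forcing is a preorder `P`, and `p ≤ q` means that `q` extends `p`. -/

/-- `U` is dense in `P`. -/
def IsDenseSubset {P : Type u} [Preorder P] (U : Set P) : Prop :=
  ∀ p : P, ∃ q ∈ U, p ≤ q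

/-- `P` is `<lam`-distributive: the intersection of fewer than `lam` many dense open subsets of `P`
is dense. -/
def IsDistributiveBelow (lam : Cardinal.{u}) (P : Type u) [Preorder P] : Prop :=
  ∀ (ι : Type u) (U : ι → Set P), #ι < lam →
    (∀ i, IsUpperSet (U i) ∧ IsDenseSubset (U i)) → IsDenseSubset (⋂ i, U i)

/-- `P` is explicitly `S`-closed. -/
def IsExplicitlyClosed {lam : Cardinal.{u}} (S : Set (Set.Iio lam.ord))
    (P : Type u) [Preorder P] : Prop :=
  ∃ δ : P → Set.Iio lam.ord,
    (∀ p q, p ≤ q → δ p ≤ δ q) ∧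
    (∀ γ, IsDenseSubset {p | γ ≤ δ p}) ∧
    ∀ (i : Ordinal.{u}) (p : Set.Iio i → P), i ≠ 0 → Monotone p →
      (∀ j k, j < k → δ (p j) < δ (p k)) →
      ∀ α ∈ S, IsLUB (Set.range fun j => δ (p j)) α →
        ∃ q, (∀ j, p j ≤ q) ∧ δ q = α

/-! ### The game for strategic closure -/

/-- The two players. -/
inductive Player
  | incompleteness
  | completeness

/-- `Moves i pl`: the player `pl` makes move number `i`. The players alternate; incompleteness makes
the first move, and completeness moves at limit steps. -/
inductive Moves : Ordinal.{u} → Player → Prop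
  | zero : Moves 0 Player.incompleteness
  | succ_incompleteness (i : Ordinal.{u}) :
      Moves i Player.incompleteness → Moves (succ i) Player.completeness
  | succ_completeness (i : Ordinal.{u}) :
      Moves i Player.completeness → Moves (succ i) Player.incompleteness
  | limit (i : Ordinal.{u}) : IsSuccLimit i → Moves i Player.completeness

/-- A move is a condition together with an ordinal below `lam`. -/
abbrev GameMove (lam : Cardinal.{u}) (P : Type u) : Type (u + 1) :=
  P × Set.Iio lam.ord

/-- The sequence of the first `i` moves. -/
abbrev History (lam : Cardinal.{u}) (P : Type u) (i : Ordinal.{u}) : Type (u + 1) :=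
  Set.Iio i → GameMove lam P

/-- The moves made before move number `j`. -/
def History.before {lam : Cardinal.{u}} {P : Type u} {i : Ordinal.{u}}
    (h : History lam P i) (j : Set.Iio i) : History lam P j.1 :=
  fun k => h ⟨k.1, lt_trans (Set.mem_Iio.1 k.2) (Set.mem_Iio.1 j.2)⟩

/-- After the moves `h`, the rules allow the move `m`: the conditions increase, the ordinals strictly
increase, and at limit steps the ordinal is the supremum of the previous ones. -/
structure IsAllowed {lam : Cardinal.{u}} {P : Type u} [Preorder P] {i : Ordinal.{u}}
    (h : History lam P i) (m : GameMove lam P) : Prop where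
  le_condition : ∀ j, (h j).1 ≤ m.1
  lt_ordinal : ∀ j, (h j).2 < m.2
  continuous : IsSuccLimit i → IsLUB (Set.range fun j => (h j).2) m.2

/-- All the moves in `h` respect the rules, and incompleteness has not lost at any limit stage below
`i`, that is, at these stages the ordinals lie in `S`. -/
def IsUndecided {lam : Cardinal.{u}} (S : Set (Set.Iio lam.ord)) {P : Type u} [Preorder P]
    {i : Ordinal.{u}} (h : History lam P i) : Prop :=
  ∀ j : Set.Iio i, IsAllowed (h.before j) (h j) ∧ (IsSuccLimit j.1 → (h j).2 ∈ S)

/-- A strategy for completeness assigns a move to each history. -/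
abbrev Strategy (lam : Cardinal.{u}) (P : Type u) : Type (u + 1) :=
  (i : Ordinal.{u}) → History lam P i → GameMove lam P

/-- In `h`, completeness has followed the strategy `σ`. -/
def Strategy.IsFollowedBy {lam : Cardinal.{u}} {P : Type u} (σ : Strategy lam P)
    {i : Ordinal.{u}} (h : History lam P i) : Prop :=
  ∀ j : Set.Iio i, Moves j.1 Player.completeness → h j = σ j.1 (h.before j)

/-- The strategy `σ` is winning for completeness: whenever it is the turn of completeness at some stage
`i < lam` of a play that follows `σ`, and incompleteness has not lost (which at a limit stage `i`
happens if the supremum of the ordinals played is outside `S`), then `σ` gives a move that the rules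
allow. At a limit stage this includes that the conditions played have an upper bound. Plays of length
`lam` are won by completeness. -/
def Strategy.IsWinning {lam : Cardinal.{u}} (S : Set (Set.Iio lam.ord)) {P : Type u} [Preorder P]
    (σ : Strategy lam P) : Prop :=
  ∀ (i : Ordinal.{u}) (h : History lam P i), i < lam.ord → Moves i Player.completeness →
    IsUndecided S h → σ.IsFollowedBy h →
    (IsSuccLimit i → ∃ ε ∈ S, IsLUB (Set.range fun j => (h j).2) ε) →
    IsAllowed h (σ i h)

/-- `P` is strategically `S`-closed. -/
def IsStrategicallyClosed {lam : Cardinal.{u}} (S : Set (Set.Iio lam.ord))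
    (P : Type u) [Preorder P] : Prop :=
  ∃ σ : Strategy lam P, σ.IsWinning S

/-! ### Names and the forcing relation

The ground model consists of the sets in the universe `u`, coded by `PSet.{u}`. -/

/-- `P`-names: a name is a set of pairs consisting of a name and a condition. -/
inductive PName (P : Type u) : Type (u + 1)
  | mk (ι : Type u) (elt : ι → PName P) (cond : ι → P) : PName P

namespace PName

variable {P : Type u}

/-- The canonical name `{(y̌, p) : y ∈ x, p ∈ P}` for the ground model set `x`. -/
def check : PSet.{u} → PName P
  | ⟨α, A⟩ => mk (α × P) (fun a => check (A a.1)) (fun a => a.2)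

variable [Preorder P]

/-- `forcesEq a b p`: the condition `p` forces `a = b`. That is, for every pair `(c, r)` in `a`, each
common extension of `p` and `r` forces `c ∈ b`, and vice versa. Since the common extensions `q` are
closed upwards, `q` forcing `c ∈ b` for all of them is spelled out as: some extension of `q` extends
`s` and forces `c = d` for some pair `(d, s)` in `b`. -/
def forcesEq : PName P → PName P → P → Prop
  | ⟨_, a, r⟩, ⟨_, b, s⟩ => fun p =>
    (∀ i q, p ≤ q → r i ≤ q → ∃ q', q ≤ q' ∧ ∃ j, s j ≤ q' ∧ forcesEq (a i) (b j) q') ∧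
    (∀ j q, p ≤ q → s j ≤ q → ∃ q', q ≤ q' ∧ ∃ i, r i ≤ q' ∧ forcesEq (a i) (b j) q')

/-- `forcesMem a b p`: the condition `p` forces `a ∈ b`. That is, densely above `p` there are
conditions `q` such that for some pair `(c, s)` in `b`, `q` extends `s` and forces `a = c`. -/
def forcesMem (a : PName P) : PName P → P → Prop
  | ⟨_, b, s⟩ => fun p =>
    ∀ q, p ≤ q → ∃ r, q ≤ r ∧ ∃ j, s j ≤ r ∧ forcesEq a (b j) r

end PName

/-! A statement of the forcing language is represented by the set of conditions that force it. The
connectives and quantifiers are interpreted by the standard recursion for the forcing relation, the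
quantifiers ranging over all `P`-names. -/

/-- Statements of the forcing language. -/
abbrev ForcingStatement (P : Type u) : Type u := P → Prop

namespace ForcingStatement

variable {P : Type u} [Preorder P]

/-- `a = b` -/
def eq (a b : PName P) : ForcingStatement P := PName.forcesEq a b

/-- `a ∈ b` -/
def mem (a b : PName P) : ForcingStatement P := PName.forcesMem a b

/-- conjunction -/
def and (φ ψ : ForcingStatement P) : ForcingStatement P := fun p => φ p ∧ ψ p

/-- disjunction -/
def or (φ ψ : ForcingStatement P) : ForcingStatement P :=
  fun p => ∀ q, p ≤ q → ∃ r, q ≤ r ∧ (φ r ∨ ψ r)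

/-- implication -/
def imp (φ ψ : ForcingStatement P) : ForcingStatement P := fun p => ∀ q, p ≤ q → φ q → ψ q

/-- universal quantifier -/
def all (φ : PName P → ForcingStatement P) : ForcingStatement P := fun p => ∀ x, φ x p

/-- existential quantifier -/
def ex (φ : PName P → ForcingStatement P) : ForcingStatement P :=
  fun p => ∀ q, p ≤ q → ∃ r, q ≤ r ∧ ∃ x, φ x r

infix:75 " =ᶠ " => ForcingStatement.eq
infix:75 " ∈ᶠ " => ForcingStatement.mem
infixr:65 " ∧ᶠ " => ForcingStatement.and
infixr:60 " ∨ᶠ " => ForcingStatement.or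
infixr:55 " →ᶠ " => ForcingStatement.imp

/-- bi-implication -/
def iff (φ ψ : ForcingStatement P) : ForcingStatement P := (φ →ᶠ ψ) ∧ᶠ (ψ →ᶠ φ)

infix:50 " ↔ᶠ " => ForcingStatement.iff

/-- `∀ x ∈ a, φ x` -/
def allIn (a : PName P) (φ : PName P → ForcingStatement P) : ForcingStatement P :=
  all fun x => x ∈ᶠ a →ᶠ φ x

/-- `∃ x ∈ a, φ x` -/
def exIn (a : PName P) (φ : PName P → ForcingStatement P) : ForcingStatement P :=
  ex fun x => x ∈ᶠ a ∧ᶠ φ x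

/-- `a ⊆ b` -/
def subset (a b : PName P) : ForcingStatement P := allIn a fun x => x ∈ᶠ b

/-- `z = {x, y}` -/
def isUnorderedPair (z x y : PName P) : ForcingStatement P :=
  all fun w => w ∈ᶠ z ↔ᶠ (w =ᶠ x ∨ᶠ w =ᶠ y)

/-- `z` is the ordered pair `(x, y) = {{x}, {x, y}}` -/
def isPair (z x y : PName P) : ForcingStatement P :=
  ex fun v => ex fun w => isUnorderedPair v x x ∧ᶠ isUnorderedPair w x y ∧ᶠ isUnorderedPair z v w

/-- `(x, y) ∈ f` -/
def maps (f x y : PName P) : ForcingStatement P := exIn f fun z => isPair z x y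

/-- `f` is a function from `a` to `b` -/
def isFunction (f a b : PName P) : ForcingStatement P :=
  (allIn f fun z => exIn a fun x => exIn b fun y => isPair z x y) ∧ᶠ
  (allIn a fun x => exIn b fun y => maps f x y) ∧ᶠ
  (all fun x => all fun y => all fun y' => maps f x y →ᶠ maps f x y' →ᶠ y =ᶠ y')

/-- `t = θ ∪ {θ}`, that is, `t = θ + 1` for an ordinal `θ` -/
def isSuccessor (t θ : PName P) : ForcingStatement P :=
  all fun w => w ∈ᶠ t ↔ᶠ (w ∈ᶠ θ ∨ᶠ w =ᶠ θ)

/-- The ordinal `θ` is a regular cardinal: it is a nonzero limit ordinal, and every function from a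
smaller ordinal to `θ` is bounded in `θ`. -/
def isRegular (θ : PName P) : ForcingStatement P :=
  (ex fun x => x ∈ᶠ θ) ∧ᶠ
  (allIn θ fun x => exIn θ fun y => x ∈ᶠ y) ∧ᶠ
  (allIn θ fun α => all fun f => isFunction f α θ →ᶠ
    exIn θ fun β => all fun x => all fun y => maps f x y →ᶠ y ∈ᶠ β)

/-- The set of ordinals `D` is closed in the ordinal `lam`: it contains every nonzero `δ < lam` such
that `D ∩ δ` is unbounded in `δ`, in the sense that for all `β < δ` there is `γ ∈ D` with
`β < γ < δ`. -/
def isClosedIn (D lam : PName P) : ForcingStatement P :=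
  allIn lam fun δ => (ex fun x => x ∈ᶠ δ) →ᶠ
    (allIn δ fun β => exIn D fun γ => γ ∈ᶠ δ ∧ᶠ β ∈ᶠ γ) →ᶠ δ ∈ᶠ D

/-- `C` is a club of the ordinal `lam` -/
def isClub (C lam : PName P) : ForcingStatement P :=
  subset C lam ∧ᶠ (allIn lam fun α => exIn C fun β => α ∈ᶠ β) ∧ᶠ isClosedIn C lam

/-- The set of ordinals `D` has order type `θ + 1`: there is a strictly increasing function from
`θ + 1` onto `D`. -/
def hasOrderTypeSucc (D θ : PName P) : ForcingStatement P :=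
  ex fun t => ex fun f => isSuccessor t θ ∧ᶠ isFunction f t D ∧ᶠ
    (allIn D fun y => exIn t fun x => maps f x y) ∧ᶠ
    (all fun x => all fun x' => all fun y => all fun y' =>
      maps f x y →ᶠ maps f x' y' →ᶠ x ∈ᶠ x' →ᶠ y ∈ᶠ y')

/-- `S` is a fat subset of `lam` -/
def isFat (S lam : PName P) : ForcingStatement P :=
  subset S lam ∧ᶠ
  allIn lam fun θ => isRegular θ →ᶠ all fun C => isClub C lam →ᶠ
    ex fun D => subset D S ∧ᶠ subset D C ∧ᶠ isClosedIn D lam ∧ᶠ hasOrderTypeSucc D θ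

/-- The statement holds in `V(P)`: every condition forces it. -/
def HoldsInExtension (φ : ForcingStatement P) : Prop := ∀ p, φ p

end ForcingStatement

/-- A subset of the cardinal `lam`, as a set of von Neumann ordinals. -/
noncomputable def subsetToPSet {lam : Cardinal.{u}} (S : Set (Set.Iio lam.ord)) : PSet.{u} :=
  PSet.sep (fun y => ∃ α ∈ S, PSet.Equiv y (Ordinal.toPSet α.1)) (Ordinal.toPSet lam.ord)

/-- `S` is fat in `V(P)`. -/
def IsFatInExtension {lam : Cardinal.{u}} (S : Set (Set.Iio lam.ord))
    (P : Type u) [Preorder P] : Prop :=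
  (ForcingStatement.isFat (PName.check (subsetToPSet S) : PName P)
    (PName.check (Ordinal.toPSet lam.ord))).HoldsInExtension

/-! Explicit closure implies strategic closure: completeness keeps `δ` of its condition equal to the
ordinal it plays, so at a limit in `S` its own moves have an upper bound. It remains to treat
strategic closure, where the task is to play for incompleteness without losing, that is, so that the
ordinals played have all their limits in `S`.

Suppose a sequence `e` of length `θ` has all its suprema in `S`, and incompleteness plays above `e
j` at stage `j`. If every ordinal played before stage `j` lies below `e j`, then the play and `e`
have the same limits. So `e` must outgrow a function `G` of its own past. With only `b` as argument,
fatness on the club of closure points of a bound `B` would suffice; but `G` depends on the history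
below `b`, and there may be `lam` many histories. The remedy is a family of fewer than `lam` sets `F
b` for each `b`, such that every sufficiently long increasing sequence has a subsequence of length
`θ` whose initial segments are all captured (`exists_capturing_family`). This uses GCH, and
Erdős–Rado when `lam` is the successor of a singular cardinal. Fatness is applied to the longer
length and the result is thinned out (`IsFat.exists_fast_sequence`).

The resulting plays (`IsStrategicallyClosed.exists_sequence`) meet prescribed dense requirements at
all non-limit steps. Requirements of the form "enter `U i`" give distributivity. Requirements of the
form "decide a point of `S` to be in the name `C`" give a ground model sequence, closed because the
ordinals are continuous, that the last condition forces into `C`; this is fatness in the extension.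
-/

/-! ### The Erdős–Rado theorem for pairs -/

/-- The branch of `b` in the Erdős–Rado tree of the colouring `d`: its `i`-th element is the least one
that lies above the previous ones and that has the same colours over them as `b`. -/
noncomputable def erdosRadoBranch {I K Z : Type u} [LinearOrder I] [WellFoundedLT I]
    [LinearOrder K] [WellFoundedLT K] (d : I → I → Z) (b : I) : K → I :=
  open Classical in
  wellFounded_lt.fix fun i x =>
    if h : {y | ∀ j (hj : j < i), x j hj < y ∧ d (x j hj) y = d (x j hj) b}.Nonempty then
      wellFounded_lt.min _ h else b

/-- As long as the branch has stayed below `b`, the point `b` itself is a candidate, so the minimum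
exists and the default value is not used. -/
theorem erdosRadoBranch_isLeast {I K Z : Type u} [LinearOrder I] [WellFoundedLT I]
    [LinearOrder K] [WellFoundedLT K] (d : I → I → Z) (b : I) (i : K)
    (hi : ∀ j < i, erdosRadoBranch d b j < b) :
    IsLeast {y | ∀ j < i, erdosRadoBranch d b j < y ∧
      d (erdosRadoBranch d b j) y = d (erdosRadoBranch d b j) b} (erdosRadoBranch d b i) := by
  have h : {y | ∀ j < i, erdosRadoBranch d b j < y ∧
      d (erdosRadoBranch d b j) y = d (erdosRadoBranch d b j) b}.Nonempty :=
    ⟨b, fun j hj => ⟨hi j hj, rfl⟩⟩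
  have e : erdosRadoBranch d b i = wellFounded_lt.min _ h := by
    refine (WellFounded.fix_eq _ _ _).trans ?_
    exact dif_pos h
  rw [e]
  exact ⟨WellFounded.min_mem _ _ h, fun y hy =>
    le_of_not_gt fun hlt => WellFounded.notMem_of_lt_min hlt hy⟩

/-- Erdős–Rado: a colouring of the pairs from `(2 ^ κ)⁺` with at most `κ` colours has a homogeneous
set of order type `κ⁺`. -/
theorem erdosRado {κ : Cardinal.{u}} (hκ : ℵ₀ ≤ κ) {I K Z : Type u} [LinearOrder I]
    [WellFoundedLT I] [LinearOrder K] [WellFoundedLT K] (hI : #I = succ ((2 : Cardinal.{u}) ^ κ))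
    (hK' : Ordinal.type (α := K) (· < ·) = (succ κ).ord) (hZ : #Z ≤ κ) (d : I → I → Z) :
    ∃ g : K → I, StrictMono g ∧ ∃ z, ∀ i j, i < j → d (g i) (g j) = z := by
  have hK : #K = succ κ := by rw [← Ordinal.card_type (α := K) (· < ·), hK', card_ord]
  -- If some branch never reaches its `b`, then the colour of a pair on it depends only on the
  -- smaller element, and the pigeonhole principle makes it constant. Otherwise every `b` lies on
  -- its own branch and is determined by its index there and the colours before it; there are at
  -- most `κ⁺ · 2 ^ κ = 2 ^ κ` such codes, too few for `I`.
  by_cases H : ∃ b : I, ∀ i : K, erdosRadoBranch d b i < b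
  · obtain ⟨b, hb⟩ := H
    have hx : ∀ i j : K, i < j → erdosRadoBranch d b i < erdosRadoBranch d b j ∧
        d (erdosRadoBranch d b i) (erdosRadoBranch d b j) = d (erdosRadoBranch d b i) b :=
      fun i j hij => (erdosRadoBranch_isLeast d b j fun k _ => hb k).1 i hij
    obtain ⟨z, hz⟩ := infinite_pigeonhole (fun i : K => d (erdosRadoBranch d b i) b)
      (by rw [hK]; exact hκ.trans (le_succ κ))
      (by rw [hK, (isRegular_succ hκ).cof_ord]; exact lt_succ_of_le hZ)
    rw [hK] at hz
    have hle : Ordinal.type (α := K) (· < ·) ≤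
        Ordinal.type (α := (fun i : K => d (erdosRadoBranch d b i) b) ⁻¹' {z}) (· < ·) := by
      rw [hK', ord_le, Ordinal.card_type, hz]
    obtain ⟨f⟩ := Ordinal.type_le_iff'.1 hle
    have hf : ∀ i j, i < j → (f i).1 < (f j).1 := fun i j hij => f.map_rel_iff.2 hij
    exact ⟨fun i => erdosRadoBranch d b (f i).1, fun i j hij => (hx _ _ (hf i j hij)).1, z,
      fun i j hij => (hx _ _ (hf i j hij)).2.trans (f i).2⟩
  · exfalso
    push Not at H
    have H' : ∀ b : I, ∃ i : K, (∀ j < i, erdosRadoBranch d b j < b) ∧ erdosRadoBranch d b i = b := by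
      intro b
      have hne : {i : K | b ≤ erdosRadoBranch d b i}.Nonempty := H b
      refine ⟨wellFounded_lt.min _ hne, fun j hj => ?_, ?_⟩
      · by_contra hjb
        exact WellFounded.not_lt_min _ (s := {i : K | b ≤ erdosRadoBranch d b i}) (not_lt.1 hjb) hj
      · have hlt : ∀ j < wellFounded_lt.min _ hne, erdosRadoBranch d b j < b := fun j hj => by
          by_contra hjb
          exact WellFounded.not_lt_min _ (s := {i : K | b ≤ erdosRadoBranch d b i}) (not_lt.1 hjb) hj
        exact le_antisymm ((erdosRadoBranch_isLeast d b _ hlt).2 fun j hj => ⟨hlt j hj, rfl⟩)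
          (WellFounded.min_mem _ _ hne)
    choose l hl hlb using H'
    have hinj : Function.Injective fun b : I =>
        (⟨l b, fun j => d (erdosRadoBranch d b j.1) b⟩ : Σ i : K, (Set.Iio i → Z)) := by
      intro b c hbc
      obtain ⟨h1, h2⟩ := Sigma.mk.inj_iff.1 hbc
      have h3 : ∀ j < l b, d (erdosRadoBranch d b j) b = d (erdosRadoBranch d c j) c := by
        intro j hj
        have : ∀ (i i' : K) (F : Set.Iio i → Z) (G : Set.Iio i' → Z), i = i' → F ≍ G →
            ∀ j (hj : j < i) (hj' : j < i'), F ⟨j, hj⟩ = G ⟨j, hj'⟩ := by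
          rintro i _ F _ rfl h j _ _
          rw [eq_of_heq h]
        exact this _ _ _ _ h1 h2 j hj (h1 ▸ hj)
      have h4 : ∀ j, j ≤ l b → erdosRadoBranch d b j = erdosRadoBranch d c j := by
        intro j
        induction j using WellFoundedLT.induction with
        | ind j ih =>
        intro hj
        have hb := erdosRadoBranch_isLeast d b j fun k hk => hl b k (hk.trans_le hj)
        have hc := erdosRadoBranch_isLeast d c j fun k hk => hl c k (hk.trans_le (h1 ▸ hj))
        refine hb.unique ?_
        convert hc using 3 with y
        refine forall₂_congr fun k hk => ?_
        rw [h3 k (hk.trans_le hj), ih k hk (hk.le.trans hj)]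
      have h5 := h4 (l b) le_rfl
      have h1' : l b = l c := h1
      rw [hlb] at h5
      rw [h5, h1', hlb]
    have hcard := mk_le_of_injective hinj
    have h2κ : κ ≤ 2 ^ κ := (cantor κ).le
    rw [hI, mk_sigma] at hcard
    have : sum (fun i : K => #(Set.Iio i → Z)) ≤ 2 ^ κ := by
      calc sum (fun i : K => #(Set.Iio i → Z)) ≤ sum (fun _ : K => (2 : Cardinal.{u}) ^ κ) := by
            refine sum_le_sum _ _ fun i => ?_
            have hi : #(Set.Iio i) ≤ κ := lt_succ_iff.1 ((mk_Iio_lt i (by rw [hK, hK'])).trans_eq hK)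
            rw [← power_def]
            calc #Z ^ #(Set.Iio i) ≤ (2 ^ κ) ^ #(Set.Iio i) := power_le_power_right (hZ.trans h2κ)
              _ ≤ (2 ^ κ) ^ κ := power_le_power_left (power_ne_zero _ two_ne_zero) hi
              _ = 2 ^ κ := by rw [← power_mul, mul_eq_self hκ]
        _ = #K * 2 ^ κ := by simp
        _ ≤ 2 ^ κ * 2 ^ κ := by
            rw [hK]; exact mul_le_mul_left (succ_le_of_lt (cantor κ)) _
        _ = 2 ^ κ := mul_eq_self (hκ.trans h2κ)
    exact (lt_succ ((2 : Cardinal.{u}) ^ κ)).not_ge (hcard.trans this)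

/-! ### Few sets that capture homogeneous sequences -/

theorem GCHBelow.two_power_le {lam : Cardinal.{u}} (h : GCHBelow lam)
    {κ μ : Cardinal.{u}} (hκ : κ < μ) (hμ : ℵ₀ ≤ μ) (hμl : μ ≤ lam) :
    (2 : Cardinal.{u}) ^ κ ≤ μ := by
  rcases lt_or_ge κ ℵ₀ with h0 | h0
  · exact ((power_lt_aleph0 (natCast_lt_aleph0 (n := 2)) h0).le).trans hμ
  · rw [h κ h0 (hκ.trans_le hμl)]
    exact succ_le_of_lt hκ

theorem mk_Iio_toType_lt {lam : Cardinal.{u}} (b : lam.ord.ToType) : #(Set.Iio b) < lam := by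
  simpa using mk_Iio_lt b (by simp)

theorem strictMono_toType_ordinal_le {θ κ : Cardinal.{u}} (h : θ ≤ κ) :
    ∃ f : θ.ord.ToType → κ.ord.ToType, StrictMono f := by
  have : Ordinal.type (α := θ.ord.ToType) (· < ·) ≤ Ordinal.type (α := κ.ord.ToType) (· < ·) := by
    simpa using h
  obtain ⟨f⟩ := Ordinal.type_le_iff'.1 this
  exact ⟨f, fun i j hij => f.map_rel_iff.2 hij⟩

/-- Below an uncountable cardinal `lam` with GCH, one can choose fewer than `lam` many subsets of each
`b < lam` such that each sufficiently long increasing sequence has a subsequence of given regular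
length whose initial segments are among the chosen sets. -/
theorem exists_capturing_family {lam : Cardinal.{u}} (hunc : ℵ₀ < lam)
    (hGCH : GCHBelow lam) :
    ∃ F : lam.ord.ToType → Set (Set lam.ord.ToType), (∀ b, #(F b) < lam) ∧
      ∀ θ : Cardinal.{u}, θ.IsRegular → θ < lam →
        ∃ θ' : Cardinal.{u}, θ'.IsRegular ∧ θ' < lam ∧
          ∀ e : θ'.ord.ToType → lam.ord.ToType, StrictMono e →
            ∃ g : θ.ord.ToType → θ'.ord.ToType, StrictMono g ∧
              ∀ j, (fun i => e (g i)) '' Set.Iio j ∈ F (e (g j)) := by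
  by_cases hlim : ∃ μ, lam = succ μ
  swap
  -- If `lam` is not a successor, GCH makes it a strong limit, and all subsets of `b` can be taken.
  · refine ⟨fun b => 𝒫 (Set.Iio b), fun b => ?_, fun θ hθ hθl => ⟨θ, hθ, hθl, fun e he =>
      ⟨id, strictMono_id, fun j => ?_⟩⟩⟩
    · rw [mk_powerset]
      have hb := mk_Iio_toType_lt b
      refine lt_of_le_of_ne (hGCH.two_power_le hb hunc.le le_rfl) fun h => ?_
      rcases lt_or_ge #(Set.Iio b) ℵ₀ with h0 | h0
      · exact ((power_lt_aleph0 (natCast_lt_aleph0 (n := 2)) h0).trans hunc).ne h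
      · exact hlim ⟨_, h.symm.trans (hGCH _ h0 hb)⟩
    · rintro _ ⟨i, hi, rfl⟩
      exact he hi
  · obtain ⟨μ, rfl⟩ := hlim
    have hμ : ℵ₀ ≤ μ := lt_succ_iff.1 hunc
    set L := (succ μ).ord.ToType
    have hf : ∀ b : L, ∃ f : L → μ.ord.ToType, Set.InjOn f (Set.Iio b) := by
      intro b
      have hb : #(Set.Iio b) ≤ #μ.ord.ToType := by
        simpa using lt_succ_iff.1 (mk_Iio_toType_lt b)
      obtain ⟨f⟩ := hb
      have : Nonempty μ.ord.ToType := by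
        rw [← mk_ne_zero_iff]
        simpa using (aleph0_pos.trans_le hμ).ne'
      refine ⟨fun x => if h : x < b then f ⟨x, h⟩ else Classical.arbitrary _, ?_⟩
      intro x hx y hy hxy
      simp only [Set.mem_Iio] at hx hy
      beta_reduce at hxy
      rw [dif_pos hx, dif_pos hy] at hxy
      exact congrArg Subtype.val (f.injective hxy)
    choose f hf using hf
    -- A `b` of size `μ` has `lam` many subsets. Only those with bounded image under a fixed
    -- injection of `b` into `μ` are kept; by GCH there are at most `μ` of them.
    refine ⟨fun b => ⋃ z, 𝒫 {x | x < b ∧ f b x < z}, fun b => ?_, fun θ hθ hθl => ?_⟩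
    · rw [lt_succ_iff]
      refine (mk_iUnion_le _).trans ?_
      refine (mul_le_mul_right (ciSup_le' (a := μ) fun z => ?_) _).trans ?_
      · rw [mk_powerset]
        refine hGCH.two_power_le (lt_of_le_of_lt ?_ (mk_Iio_toType_lt z)) hμ (le_succ μ)
        refine mk_le_of_injective (f := fun x : {x | x < b ∧ f b x < z} =>
          (⟨f b x.1, x.2.2⟩ : Set.Iio z)) fun x y hxy => ?_
        exact Subtype.ext (hf b x.2.1 y.2.1 (congrArg Subtype.val hxy))
      · simp [mul_eq_self hμ]
    · rcases isRegular_or_isSingular hμ with hμr | hμs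
      -- For regular `μ`, an initial segment has fewer than `θ ≤ μ` elements, so its image in `μ` is
      -- bounded and no thinning is needed.
      · refine ⟨θ, hθ, hθl, fun e he => ⟨id, strictMono_id, fun j => ?_⟩⟩
        have hj : #(f (e j) '' (e '' Set.Iio j)) < Order.cof μ.ord.ToType := by
          rw [Ordinal.cof_toType, hμr.cof_ord]
          exact mk_image_le.trans_lt (mk_image_le.trans_lt
            ((mk_Iio_toType_lt j).trans_le (lt_succ_iff.1 hθl)))
        have hnc : ¬ IsCofinal (f (e j) '' (e '' Set.Iio j)) := fun h => (cof_le h).not_gt hj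
        simp only [IsCofinal, not_forall, not_exists, not_and, not_le] at hnc
        obtain ⟨z, hz⟩ := hnc
        refine Set.mem_iUnion.2 ⟨z, ?_⟩
        rintro _ ⟨i, hi, rfl⟩
        exact ⟨he hi, hz _ ⟨_, ⟨i, hi, rfl⟩, rfl⟩⟩
      -- For singular `μ`, small sets can be unbounded in `μ`. Colour a pair `x < y` by a member of
      -- the short cofinal set `Z` above the image of `e x` under the injection for `e y`: on a
      -- homogeneous set one colour `z` bounds all these images. Since `μ` is a limit cardinal, GCH
      -- keeps `(2 ^ κ)⁺` below it.
      · obtain ⟨Z, hZ, hZc⟩ := Order.exists_cof_eq μ.ord.ToType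
        rw [Ordinal.cof_toType] at hZc
        have hθμ : θ < μ := lt_of_le_of_ne (lt_succ_iff.1 hθl) fun h =>
          hμs.not_isRegular (h ▸ hθ)
        set κ := max θ #Z
        have hκ : ℵ₀ ≤ κ := hθ.aleph0_le.trans (le_max_left _ _)
        have hκμ : κ < μ := max_lt hθμ (hZc ▸ hμs.cof_ord_lt)
        have h2κ : (2 : Cardinal.{u}) ^ κ < μ :=
          (hGCH.two_power_le (lt_succ κ) (hκ.trans (le_succ _))
            ((hμs.isSuccLimit.succ_lt hκμ).le.trans (le_succ μ))).trans_lt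
            (hμs.isSuccLimit.succ_lt hκμ)
        refine ⟨succ ((2 : Cardinal.{u}) ^ κ), isRegular_succ (hκ.trans (cantor κ).le),
          (hμs.isSuccLimit.succ_lt h2κ).trans (lt_succ μ), fun e he => ?_⟩
        have : NoMaxOrder μ.ord.ToType := Cardinal.noMaxOrder hμ
        have hd : ∀ x y : L, ∃ z ∈ Z, f y x < z := fun x y => by
          obtain ⟨w, hw⟩ := exists_gt (f y x)
          obtain ⟨z, hz, hwz⟩ := hZ w
          exact ⟨z, hz, hw.trans_le hwz⟩
        choose d hdZ hd using hd
        obtain ⟨g, hg, z, hz⟩ := erdosRado hκ (K := (succ κ).ord.ToType) (Z := Z)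
          (by simp) (by simp) (le_max_right _ _)
          (fun x y : (succ ((2 : Cardinal.{u}) ^ κ)).ord.ToType => ⟨d (e x) (e y), hdZ _ _⟩)
        obtain ⟨k, hk⟩ := strictMono_toType_ordinal_le ((le_max_left θ #Z).trans (le_succ κ))
        refine ⟨fun i => g (k i), hg.comp hk, fun j => Set.mem_iUnion.2 ⟨z, ?_⟩⟩
        rintro _ ⟨i, hi, rfl⟩
        refine ⟨he (hg (hk hi)), ?_⟩
        rw [← hz _ _ (hk hi)]
        exact hd _ _

/-! ### Bounds below a regular cardinal -/

theorem exists_isLUB_of_bddAbove {α : Type*} [LinearOrder α] [WellFoundedLT α] {s : Set α}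
    (h : BddAbove s) : ∃ a, IsLUB s a :=
  ⟨wellFounded_lt.min _ h, WellFounded.min_mem _ _ h, fun _ hy =>
    le_of_not_gt fun hlt => WellFounded.notMem_of_lt_min hlt hy⟩

theorem Cardinal.IsRegular.exists_forall_lt {lam : Cardinal.{u}} (hreg : lam.IsRegular) {J : Type u}
    (hJ : #J < lam) (f : J → Set.Iio lam.ord) : ∃ b, ∀ k, f k < b := by
  have h : ⨆ k, ((f k).1 + 1) < lam.ord := by
    refine Ordinal.iSup_lt_of_lt_cof (by rwa [hreg.cof_ord]) fun k => ?_
    exact (isSuccLimit_ord hreg.aleph0_le).succ_lt (f k).2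
  refine ⟨⟨_, h⟩, fun k => ?_⟩
  refine Subtype.coe_lt_coe.1 ?_
  exact (lt_add_one (f k).1).trans_le (Ordinal.le_iSup (fun k => (f k).1 + 1) k)

theorem Cardinal.IsRegular.exists_gt_Iio {lam : Cardinal.{u}} (hreg : lam.IsRegular)
    (a : Set.Iio lam.ord) : ∃ b, a < b :=
  ⟨⟨succ a.1, (isSuccLimit_ord hreg.aleph0_le).succ_lt a.2⟩, lt_succ a.1⟩

/-- For unboundedness, iterate `ω` times a step that dominates all earlier values of `B`; the
supremum stays below `lam`, which is regular and uncountable. -/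
theorem isClub_closurePoints {lam : Cardinal.{u}} (hreg : lam.IsRegular) (hunc : ℵ₀ < lam)
    (B : Set.Iio lam.ord → Set.Iio lam.ord) : IsClub {a | ∀ b < a, B b < a} := by
  refine ⟨fun d hd _ _ a ha b hb => ?_, fun a => ?_⟩
  · obtain ⟨x, hx, hbx⟩ := (lt_isLUB_iff ha).1 hb
    exact (hd hx b hbx).trans_le (ha.1 hx)
  · have step : ∀ x : Set.Iio lam.ord, ∃ y, x < y ∧ ∀ b < x, B b < y := by
      intro x
      obtain ⟨y, hy⟩ := hreg.exists_forall_lt (J := x.1.ToType) (by simpa using lt_ord.1 x.2)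
        fun t => B ⟨(Ordinal.ToType.mk.symm t).1,
          lt_trans (Set.mem_Iio.1 (Ordinal.ToType.mk.symm t).2) x.2⟩
      obtain ⟨z, hz⟩ := hreg.exists_gt_Iio x
      refine ⟨max y z, hz.trans_le (le_max_right _ _), fun b hb => ?_⟩
      have := hy (Ordinal.ToType.mk ⟨b.1, hb⟩)
      simp only [OrderIso.symm_apply_apply] at this
      exact this.trans_le (le_max_left _ _)
    choose nxt hnxt hB using step
    have hmem : ∀ n : ℕ, nxt^[n] a ≤ nxt^[n + 1] a := fun n => by
      rw [Function.iterate_succ_apply']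
      exact (hnxt _).le
    obtain ⟨b, hb⟩ := hreg.exists_forall_lt (J := ULift ℕ) (by simpa using hunc)
      fun n => nxt^[n.down] a
    obtain ⟨c, hc⟩ := exists_isLUB_of_bddAbove (s := Set.range fun n => nxt^[n] a)
      ⟨b, by rintro _ ⟨n, rfl⟩; exact (hb ⟨n⟩).le⟩
    refine ⟨c, fun x hx => ?_, hc.1 ⟨0, rfl⟩⟩
    obtain ⟨_, ⟨n, rfl⟩, hn⟩ := (lt_isLUB_iff hc).1 hx
    refine (hB _ _ hn).trans_le (hc.1 ⟨n + 1, ?_⟩)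
    exact Function.iterate_succ_apply' _ _ _

/-- An increasing sequence is determined by the set of its values. -/
theorem StrictMono.eq_of_image_Iio_eq {α β : Type*} [LinearOrder α] [WellFoundedLT α] [LinearOrder β]
    {e e' : α → β} (he : StrictMono e) (he' : StrictMono e') {j : α}
    (h : e '' Set.Iio j = e' '' Set.Iio j) : ∀ i < j, e i = e' i := by
  intro i
  induction i using WellFoundedLT.induction with
  | ind i ih =>
  intro hi
  apply le_antisymm
  · obtain ⟨m, hm, hme⟩ := h.ge ⟨i, hi, rfl⟩
    rw [← hme]
    refine he.monotone (le_of_not_gt fun hmi => ?_)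
    rw [ih m hmi hm] at hme
    exact hmi.ne (he'.injective hme)
  · obtain ⟨m, hm, hme⟩ := h.le ⟨i, hi, rfl⟩
    rw [← hme]
    refine he'.monotone (le_of_not_gt fun hmi => ?_)
    rw [← ih m hmi hm] at hme
    exact hmi.ne (he.injective hme)

/-- If `S` is fat then there are increasing sequences of given regular length with suprema in `S` that
grow faster than a given function of the previous part of the sequence. -/
theorem IsFat.exists_fast_sequence {lam : Cardinal.{u}} (hreg : lam.IsRegular) (hunc : ℵ₀ < lam)
    (hGCH : GCHBelow lam) {S : Set (Set.Iio lam.ord)} (hS : IsFat S) {θ : Cardinal.{u}}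
    (hθ : θ.IsRegular) (hθl : θ < lam)
    (G : (Set.Iio θ.ord → Set.Iio lam.ord) → Set.Iio θ.ord → Set.Iio lam.ord)
    (hG : ∀ e e' j, (∀ i ≤ j, e i = e' i) → G e j = G e' j) :
    ∃ e : Set.Iio θ.ord → Set.Iio lam.ord, StrictMono e ∧ (∀ i j, i < j → G e i < e j) ∧
      (∀ T : Set (Set.Iio θ.ord), T.Nonempty → ∃ a ∈ S, IsLUB (e '' T) a) := by
  obtain ⟨F, hF, hcap⟩ := exists_capturing_family hunc hGCH
  obtain ⟨θ', hθ', hθ'l, hcap⟩ := hcap θ hθ hθl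
  let m := Ordinal.ToType.mk (o := lam.ord)
  -- A captured set of previous values and a position `j` determine `e` up to `j`, hence `G e j`. So
  -- only fewer than `lam` many values have to be bounded at `b`.
  have hB : ∀ b : Set.Iio lam.ord, ∃ c, ∀ (e : Set.Iio θ.ord → Set.Iio lam.ord) (j : Set.Iio θ.ord),
      StrictMono e → e j = b → m '' (e '' Set.Iio j) ∈ F (m b) → G e j < c := by
    intro b
    have hval : ∀ x : F (m b) × θ.ord.ToType, ∃ c,
        ∀ (e : Set.Iio θ.ord → Set.Iio lam.ord) (j : Set.Iio θ.ord),
          StrictMono e → e j = b → m '' (e '' Set.Iio j) = x.1 → Ordinal.ToType.mk j = x.2 →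
            G e j = c := by
      rintro ⟨X, t⟩
      by_cases H : ∃ (e : Set.Iio θ.ord → Set.Iio lam.ord) (j : Set.Iio θ.ord),
          StrictMono e ∧ e j = b ∧ m '' (e '' Set.Iio j) = X ∧ Ordinal.ToType.mk j = t
      · obtain ⟨e, j, he, hej, hX, hj⟩ := H
        refine ⟨G e j, fun e' j' he' hej' hX' hj' => ?_⟩
        obtain rfl : j = j' := Ordinal.ToType.mk.injective (hj.trans hj'.symm)
        refine hG _ _ _ fun i hi => ?_
        rcases hi.lt_or_eq with hi | rfl
        · refine he'.eq_of_image_Iio_eq he (m.injective.image_injective (hX'.trans hX.symm)) i hi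
        · rw [hej, hej']
      · exact ⟨b, fun e j he hej hX hj => (H ⟨e, j, he, hej, hX, hj⟩).elim⟩
    choose v hv using hval
    obtain ⟨c, hc⟩ := hreg.exists_forall_lt (J := F (m b) × θ.ord.ToType)
      (by simpa using mul_lt_of_lt hreg.aleph0_le (hF (m b)) hθl) v
    refine ⟨c, fun e j he hej hX => ?_⟩
    rw [hv (⟨_, hX⟩, Ordinal.ToType.mk j) e j he hej rfl rfl]
    exact hc _
  choose B hB using hB
  obtain ⟨D, hD, hDc, ⟨h⟩⟩ := hS θ' hθ' hθ'l _ (isClub_closurePoints hreg hunc B)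
  let n := Ordinal.ToType.mk (o := θ'.ord)
  let e0 : θ'.ord.ToType → Set.Iio lam.ord := fun i =>
    (h ⟨(n.symm i).1, (Set.mem_Iio.1 (n.symm i).2).le⟩).1
  have he0 : StrictMono e0 := fun i j hij => h.strictMono (n.symm.strictMono hij)
  obtain ⟨g, hg, hgF⟩ := hcap (fun i => m (e0 i)) (m.strictMono.comp he0)
  let e : Set.Iio θ.ord → Set.Iio lam.ord := fun i => e0 (g (Ordinal.ToType.mk i))
  have he : StrictMono e := he0.comp (hg.comp Ordinal.ToType.mk.strictMono)
  have heD : ∀ i, e i ∈ D := fun i => (h _).2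
  refine ⟨e, he, fun i j hij => ?_, fun T hT => ?_⟩
  · refine (hB (e i) e i he rfl ?_).trans ((hD (heD j)).2 _ (he hij))
    convert! hgF (Ordinal.ToType.mk i)
    ext x
    simp only [Set.mem_image, Set.mem_Iio, exists_exists_and_eq_and]
    constructor
    · rintro ⟨k, hk, rfl⟩
      exact ⟨Ordinal.ToType.mk k, Ordinal.ToType.mk.strictMono hk, rfl⟩
    · rintro ⟨k, hk, rfl⟩
      refine ⟨Ordinal.ToType.mk.symm k, (OrderIso.symm_apply_lt _).2 hk, ?_⟩
      simp [e, m]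
  -- The last point of `D` bounds the thinned sequence. Its suprema are suprema of subsets of the
  -- closed set `D`, so thinning does no harm.
  · obtain ⟨a, ha⟩ := exists_isLUB_of_bddAbove (s := e '' T)
      ⟨(h ⟨θ'.ord, Set.mem_Iic.2 le_rfl⟩).1, by
        rintro _ ⟨i, -, rfl⟩
        exact h.monotone (Set.mem_Iio.1 (n.symm _).2).le⟩
    refine ⟨a, (hD (hDc ?_ (hT.image e) (fun x hx y hy => ?_) ha)).1, ha⟩
    · rintro _ ⟨i, -, rfl⟩
      exact heD i
    · rcases le_total x y with hxy | hxy
      · exact ⟨y, hy, hxy, le_rfl⟩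
      · exact ⟨x, hx, le_rfl, hxy⟩

/-! ### Plays of the game -/

theorem Moves.not_completeness {i : Ordinal.{u}} (h : Moves i Player.incompleteness) :
    ¬ Moves i Player.completeness := by
  induction i using WellFoundedLT.induction with
  | ind i ih =>
  cases h with
  | zero =>
    intro h
    generalize hz : (0 : Ordinal.{u}) = z at h
    cases h with
    | succ_incompleteness k hk => exact (bot_lt_succ k).ne hz
    | limit _ hl => exact hl.ne_bot hz.symm
  | succ_completeness k hk =>
    intro h
    generalize hz : succ k = z at h
    cases h with
    | succ_incompleteness l hl =>
      rw [succ_injective hz] at hk ih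
      exact ih l (lt_succ l) hl hk
    | limit _ hl => exact hl.succ_ne k hz

theorem moves_or (i : Ordinal.{u}) :
    Moves i Player.incompleteness ∨ Moves i Player.completeness := by
  induction i using Ordinal.limitRecOn with
  | zero => exact Or.inl Moves.zero
  | add_one k ih =>
    rw [← succ_eq_add_one]
    rcases ih with h | h
    · exact Or.inr (Moves.succ_incompleteness k h)
    · exact Or.inl (Moves.succ_completeness k h)
  | limit k hk => exact Or.inr (Moves.limit k hk)

/-- The play in which every move is determined by the previous ones through the function `F`. -/
noncomputable def playOf {lam : Cardinal.{u}} {P : Type u} (F : Strategy lam P)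
    (j : Ordinal.{u}) : GameMove lam P :=
  wellFounded_lt.fix (C := fun _ => GameMove lam P) (fun j h => F j fun k => h k.1 k.2) j

theorem playOf_eq {lam : Cardinal.{u}} {P : Type u} (F : Strategy lam P) (j : Ordinal.{u}) :
    playOf F j = F j fun k => playOf F k.1 :=
  WellFounded.fix_eq _ _ _

/-- For a play driven by a sequence `e`, this makes move `j` depend only on `e` up to `j`, as
`IsFat.exists_fast_sequence` demands of `G`. -/
theorem playOf_congr {lam : Cardinal.{u}} {P : Type u} {F F' : Strategy lam P} {j : Ordinal.{u}}
    (h : ∀ i ≤ j, F i = F' i) : playOf F j = playOf F' j := by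
  induction j using WellFoundedLT.induction with
  | ind j ih =>
  rw [playOf_eq, playOf_eq, h j le_rfl]
  congr 1
  ext1 k
  exact ih k.1 k.2 fun i hi => h i (hi.trans (le_of_lt k.2))

/-- If `P` is strategically `S`-closed for a fat set `S`, then there are increasing sequences of
conditions of regular length in which incompleteness realizes given dense requirements `U`. -/
theorem IsStrategicallyClosed.exists_play {lam : Cardinal.{u}} (hreg : lam.IsRegular)
    (hunc : ℵ₀ < lam) (hGCH : GCHBelow lam) {S : Set (Set.Iio lam.ord)} (hS : IsFat S)
    {P : Type u} [Preorder P] (hP : IsStrategicallyClosed S P) {θ : Cardinal.{u}}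
    (hθ : θ.IsRegular) (hθl : θ < lam) (p : P) (U : Ordinal.{u} → P → Set.Iio lam.ord → Prop)
    (hU : ∀ i q γ, p ≤ q → ∃ r s, q ≤ r ∧ γ < s ∧ U i r s) :
    ∃ m : Ordinal.{u} → GameMove lam P, (∀ j ≤ θ.ord, p ≤ (m j).1) ∧
      (∀ i j, i < j → j ≤ θ.ord → (m i).1 ≤ (m j).1 ∧ (m i).2 < (m j).2) ∧
      (∀ j ≤ θ.ord, IsSuccLimit j →
        (m j).2 ∈ S ∧ IsLUB ((fun k => (m k).2) '' Set.Iio j) (m j).2) ∧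
      ∀ j < θ.ord, Moves j Player.incompleteness → U j (m j).1 (m j).2 := by
  classical
  obtain ⟨σ, hσ⟩ := hP
  have hlim : IsSuccLimit θ.ord := isSuccLimit_ord hθ.aleph0_le
  have z0 : Set.Iio lam.ord := ⟨0, hreg.ord_pos⟩
  let inc (b : Set.Iio lam.ord) : Strategy lam P := fun j h =>
    if H : ∃ x : GameMove lam P, p ≤ x.1 ∧ (∀ k, (h k).1 ≤ x.1) ∧ (∀ k, (h k).2 < x.2) ∧ b < x.2 ∧
      U j x.1 x.2 then H.choose else (p, b)
  -- The value `z0` is irrelevant: `θ.ord` is a limit, so up to that stage incompleteness moves only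
  -- at stages below it.
  let F (e : Set.Iio θ.ord → Set.Iio lam.ord) : Strategy lam P := fun j =>
    if Moves j Player.completeness then σ j else
      inc (if hj : j < θ.ord then e ⟨j, hj⟩ else z0) j
  -- The function to outgrow is the ordinal played at stage `j` in the play driven by `e` itself.
  obtain ⟨e, he, hGe, heS⟩ := hS.exists_fast_sequence hreg hunc hGCH hθ hθl
    (fun e j => (playOf (F e) j.1).2) fun e e' j h => by
      refine congrArg Prod.snd (playOf_congr fun i hi => ?_)
      have hi' : i < θ.ord := lt_of_le_of_lt hi j.2
      simp only [F, dif_pos hi', h ⟨i, hi'⟩ hi]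
  let m := playOf (F e)
  have key : ∀ j ≤ θ.ord, IsAllowed (fun k : Set.Iio j => m k.1) (m j) ∧ p ≤ (m j).1 ∧
      (IsSuccLimit j → (m j).2 ∈ S) ∧ ∀ hj : j < θ.ord, Moves j Player.incompleteness →
        U j (m j).1 (m j).2 ∧ e ⟨j, hj⟩ < (m j).2 := by
    intro j
    induction j using WellFoundedLT.induction with
    | ind j ih =>
    intro hj
    by_cases hc : Moves j Player.completeness
    · have hmj : m j = σ j fun k => m k.1 := by
        change playOf (F e) j = _
        rw [playOf_eq]
        simp only [F, if_pos hc]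
        rfl
      have hund : IsUndecided S (fun k : Set.Iio j => m k.1) := fun k =>
        ⟨(ih k.1 k.2 (le_trans (le_of_lt k.2) hj)).1, (ih k.1 k.2 (le_trans (le_of_lt k.2) hj)).2.2.1⟩
      have hfol : σ.IsFollowedBy (fun k : Set.Iio j => m k.1) := fun k hk => by
        change playOf (F e) k.1 = _
        rw [playOf_eq]
        simp only [F, if_pos hk]
        rfl
      -- The ordinals played interleave with `e`, so at a limit they have the same supremum, which
      -- lies in `S`. For one direction, note that one of the stages `k`, `k + 1` belongs to
      -- incompleteness, who exceeds `e` there.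
      have hsup : IsSuccLimit j → ∃ a ∈ S, IsLUB (Set.range fun k : Set.Iio j => (m k.1).2) a := by
        intro hl
        obtain ⟨a, haS, ha⟩ := heS {k | k.1 < j} ⟨⟨0, hθ.ord_pos⟩, hl.bot_lt⟩
        refine ⟨a, haS, ?_, fun b hb => ha.2 ?_⟩
        · rintro _ ⟨k, rfl⟩
          have hk : succ k.1 < j := hl.succ_lt k.2
          exact (hGe ⟨k.1, lt_of_lt_of_le k.2 hj⟩ ⟨succ k.1, hk.trans_le hj⟩
            (lt_succ k.1)).le.trans (ha.1 ⟨_, hk, rfl⟩)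
        · rintro _ ⟨k, hk, rfl⟩
          have hk' : succ k.1 < j := hl.succ_lt hk
          refine le_trans (le_of_lt ?_) (hb ⟨⟨succ k.1, hk'⟩, rfl⟩)
          obtain ⟨ha1, -, -, hk1⟩ := ih _ hk' (hk'.le.trans hj)
          rcases moves_or (succ k.1) with h | h
          · exact (he (show k < ⟨succ k.1, hk'.trans_le hj⟩ from lt_succ k.1)).trans
              (hk1 (hk'.trans_le hj) h).2
          · have hki : Moves k.1 Player.incompleteness := (moves_or k.1).resolve_right fun h' =>
              (Moves.succ_completeness _ h').not_completeness h
            exact ((ih _ hk (le_of_lt k.2)).2.2.2 k.2 hki).2.trans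
              (ha1.lt_ordinal ⟨k.1, lt_succ k.1⟩)
      have hall : IsAllowed (fun k : Set.Iio j => m k.1) (m j) := by
        rw [hmj]
        exact hσ j _ (hj.trans_lt (ord_lt_ord.2 hθl)) hc hund hfol hsup
      refine ⟨hall, ?_, fun hl => ?_, fun _ h => (h.not_completeness hc).elim⟩
      · have h0 : 0 < j := pos_iff_ne_zero.2 fun h => Moves.zero.not_completeness (h ▸ hc)
        exact (ih 0 h0 (h0.le.trans hj)).2.1.trans (hall.le_condition ⟨0, h0⟩)
      · obtain ⟨a, haS, ha⟩ := hsup hl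
        rwa [(hall.continuous hl).unique ha]
    · have hnl : ¬ IsSuccLimit j := fun h => hc (Moves.limit j h)
      have hjlt : j < θ.ord := lt_of_le_of_ne hj fun h => hnl (h ▸ hlim)
      have H : ∃ x : GameMove lam P, p ≤ x.1 ∧ (∀ k : Set.Iio j, (m k.1).1 ≤ x.1) ∧
          (∀ k : Set.Iio j, (m k.1).2 < x.2) ∧ e ⟨j, hjlt⟩ < x.2 ∧ U j x.1 x.2 := by
        rcases Ordinal.zero_or_succ_or_isSuccLimit j with rfl | ⟨k, rfl⟩ | h
        · obtain ⟨r, s, hr, hs, hrs⟩ := hU 0 p (e ⟨0, hjlt⟩) le_rfl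
          exact ⟨(r, s), hr, fun k => (not_lt_zero (Set.mem_Iio.1 k.2)).elim,
            fun k => (not_lt_zero (Set.mem_Iio.1 k.2)).elim, hs, hrs⟩
        · have hk : k < k + 1 := lt_add_one k
          obtain ⟨hak, hpk, -, -⟩ := ih k hk (hk.le.trans hj)
          obtain ⟨r, s, hr, hs, hrs⟩ := hU (k + 1) (m k).1 (max (m k).2 (e ⟨k + 1, hjlt⟩)) hpk
          refine ⟨(r, s), hpk.trans hr, fun i => ?_, fun i => ?_, (le_max_right _ _).trans_lt hs, hrs⟩
          · rcases (lt_succ_iff.1 i.2 : i.1 ≤ k).lt_or_eq with hi | hi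
            · exact (hak.le_condition ⟨i.1, hi⟩).trans hr
            · rw [hi]
              exact hr
          · refine lt_of_le_of_lt ?_ ((le_max_left _ _).trans_lt hs)
            rcases (lt_succ_iff.1 i.2 : i.1 ≤ k).lt_or_eq with hi | hi
            · exact (hak.lt_ordinal ⟨i.1, hi⟩).le
            · rw [hi]
        · exact (hnl h).elim
      have hmj : m j = H.choose := by
        change playOf (F e) j = _
        rw [playOf_eq]
        simp only [F, if_neg hc, dif_pos hjlt, inc]
        exact dif_pos H
      obtain ⟨h1, h2, h3, h4, h5⟩ := H.choose_spec
      rw [← hmj] at h1 h2 h3 h4 h5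
      exact ⟨⟨h2, h3, fun h => (hnl h).elim⟩, h1, fun h => (hnl h).elim, fun _ _ => ⟨h5, h4⟩⟩
  refine ⟨m, fun j hj => (key j hj).2.1, fun i j hij hj => ⟨(key j hj).1.le_condition ⟨i, hij⟩,
    (key j hj).1.lt_ordinal ⟨i, hij⟩⟩, fun j hj hl => ⟨(key j hj).2.2.1 hl, ?_⟩,
    fun j hj hi => ((key j hj.le).2.2.2 hj hi).1⟩
  rw [Set.image_eq_range]
  exact (key j hj).1.continuous hl

theorem two_mul_lt_ord {θ : Cardinal.{u}} (hθ : ℵ₀ ≤ θ) {i : Ordinal.{u}} (hi : i < θ.ord) :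
    2 * i < θ.ord :=
  Ordinal.isPrincipal_mul_ord hθ (lt_ord.2 ((Ordinal.card_ofNat 2).trans_lt
    ((natCast_lt_aleph0 (n := 2)).trans_le hθ))) hi

/-- If `P` is strategically `S`-closed for a fat set `S`, then there are increasing sequences of
conditions of regular length in which the successor steps realize given dense requirements `U`, and
the accompanying ordinals at limit steps are suprema that lie in `S`. -/
theorem IsStrategicallyClosed.exists_sequence {lam : Cardinal.{u}} (hreg : lam.IsRegular)
    (hunc : ℵ₀ < lam) (hGCH : GCHBelow lam) {S : Set (Set.Iio lam.ord)} (hS : IsFat S)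
    {P : Type u} [Preorder P] (hP : IsStrategicallyClosed S P) {θ : Cardinal.{u}}
    (hθ : θ.IsRegular) (hθl : θ < lam) (p : P) (U : Ordinal.{u} → P → Set.Iio lam.ord → Prop)
    (hU : ∀ i q γ, p ≤ q → ∃ r s, q ≤ r ∧ γ < s ∧ U i r s) :
    ∃ (q : Ordinal.{u} → P) (s : Ordinal.{u} → Set.Iio lam.ord), (∀ j ≤ θ.ord, p ≤ q j) ∧
      (∀ i j, i < j → j ≤ θ.ord → q i ≤ q j ∧ s i < s j) ∧
      (∀ j ≤ θ.ord, IsSuccLimit j → s j ∈ S ∧ IsLUB (s '' Set.Iio j) (s j)) ∧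
      ∀ j < θ.ord, ¬ IsSuccLimit j → U j (q j) (s j) := by
  classical
  obtain ⟨m, hm0, hm1, hm2, hm3⟩ := hP.exists_play hreg hunc hGCH hS hθ hθl p
    (fun j => U (j / 2)) fun i => hU (i / 2)
  have hlim : IsSuccLimit θ.ord := isSuccLimit_ord hθ.aleph0_le
  -- Of the stages `2 * i` and `2 * i + 1` one belongs to incompleteness, and dividing by 2 recovers
  -- `i`. For limit `i` the stage `2 * i` is chosen in order to keep continuity.
  let c : Ordinal.{u} → Ordinal.{u} := fun i =>
    if IsSuccLimit i ∨ Moves (2 * i) Player.incompleteness then 2 * i else 2 * i + 1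
  have hc1 : ∀ i, 2 * i ≤ c i := fun i => by
    simp only [c]; split_ifs
    · exact le_rfl
    · exact (lt_add_one _).le
  have hc2 : ∀ i, c i ≤ 2 * i + 1 := fun i => by
    simp only [c]; split_ifs
    · exact (lt_add_one _).le
    · exact le_rfl
  have hlt : ∀ i j : Ordinal.{u}, i < j → 2 * i + 1 < 2 * j := fun i j hij => by
    calc 2 * i + 1 < 2 * i + 2 := by gcongr; exact one_lt_two
      _ = 2 * (i + 1) := by rw [mul_add, mul_one]
      _ ≤ 2 * j := by gcongr; exact add_one_le_of_lt hij
  have hc : StrictMono c := fun i j hij => ((hc2 i).trans_lt (hlt i j hij)).trans_le (hc1 j)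
  have hcl : ∀ i, IsSuccLimit i → c i = 2 * i := fun i hi => if_pos (Or.inl hi)
  have hθ2 : c θ.ord ≤ θ.ord := by
    rw [hcl _ hlim]
    refine le_of_forall_lt fun x hx => ?_
    obtain ⟨i, hi, hxi⟩ := (Ordinal.lt_mul_iff_of_isSuccLimit hlim).1 hx
    exact hxi.trans (two_mul_lt_ord hθ.aleph0_le hi)
  have hcle : ∀ i ≤ θ.ord, c i ≤ θ.ord := fun i hi => (hc.monotone hi).trans hθ2
  refine ⟨fun i => (m (c i)).1, fun i => (m (c i)).2, fun j hj => hm0 _ (hcle j hj),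
    fun i j hij hj => hm1 _ _ (hc hij) (hcle j hj), fun j hj hl => ?_, fun j hj hl => ?_⟩
  · have h2j : IsSuccLimit (c j) := by
      rw [hcl j hl]
      exact Ordinal.isSuccLimit_mul_right two_pos hl
    obtain ⟨h1, h2⟩ := hm2 _ (hcle j hj) h2j
    refine ⟨h1, ?_, fun b hb => h2.2 ?_⟩
    · rintro _ ⟨k, hk, rfl⟩
      exact h2.1 ⟨c k, hc hk, rfl⟩
    · rintro _ ⟨x, hx, rfl⟩
      rw [Set.mem_Iio, hcl j hl] at hx
      obtain ⟨k, hk, hxk⟩ := (Ordinal.lt_mul_iff_of_isSuccLimit hl).1 hx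
      exact (hm1 x (c k) (hxk.trans_le (hc1 k)) ((hc hk).le.trans (hcle j hj))).2.le.trans
        (hb ⟨k, hk, rfl⟩)
  · have hcj : c j < θ.ord := (hc hj).trans_le hθ2
    have hdiv : c j / 2 = j := by
      simp only [c]; split_ifs
      · exact Ordinal.mul_div_cancel _ two_ne_zero
      · rw [Ordinal.mul_add_div _ two_ne_zero, Ordinal.div_eq_zero_of_lt one_lt_two, add_zero]
    have hmv : Moves (c j) Player.incompleteness := by
      simp only [c]; split_ifs with h
      · exact h.resolve_left hl
      · exact Moves.succ_completeness _ ((moves_or _).resolve_left fun h' => h (Or.inr h'))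
    have := hm3 _ hcj hmv
    rwa [hdiv] at this

/-! ### Explicit closure implies strategic closure -/

/-- The strategy picks any allowed move whose ordinal is `δ` of its condition. At successors density
of large `δ` provides one; at limits the moves of completeness are cofinal and their `δ` values
converge to the supremum in `S`. -/
theorem IsExplicitlyClosed.isStrategicallyClosed {lam : Cardinal.{u}} (hreg : lam.IsRegular)
    {S : Set (Set.Iio lam.ord)} {P : Type u} [Preorder P] [Nonempty P]
    (h : IsExplicitlyClosed S P) : IsStrategicallyClosed S P := by
  classical
  obtain ⟨δ, -, hδd, hδu⟩ := h
  have : Nonempty (Set.Iio lam.ord) := ⟨⟨0, hreg.ord_pos⟩⟩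
  let σ : Strategy lam P := fun i h =>
    if H : ∃ x, IsAllowed h x ∧ δ x.1 = x.2 then H.choose else Classical.arbitrary _
  have hσ : ∀ i (h : History lam P i), (∃ x, IsAllowed h x ∧ δ x.1 = x.2) →
      IsAllowed h (σ i h) ∧ δ (σ i h).1 = (σ i h).2 := by
    intro i h H
    simp only [σ, dif_pos H]
    exact H.choose_spec
  have key : ∀ (i : Ordinal.{u}) (h : History lam P i), Moves i Player.completeness →
      IsUndecided S h → σ.IsFollowedBy h →
      (IsSuccLimit i → ∃ ε ∈ S, IsLUB (Set.range fun j => (h j).2) ε) →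
      ∃ x, IsAllowed h x ∧ δ x.1 = x.2 := by
    intro i
    induction i using WellFoundedLT.induction with
    | ind i ih =>
    intro h hi hund hfol hsup
    have hδ : ∀ j : Set.Iio i, Moves j.1 Player.completeness → δ (h j).1 = (h j).2 := by
      intro j hj
      rw [hfol j hj]
      refine (hσ _ _ (ih j.1 j.2 (h.before j) hj (fun k => hund ⟨k.1, lt_trans (Set.mem_Iio.1 k.2) j.2⟩)
        (fun k => hfol ⟨k.1, lt_trans (Set.mem_Iio.1 k.2) j.2⟩) fun hl => ?_)).2
      exact ⟨_, (hund j).2 hl, (hund j).1.continuous hl⟩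
    have hmono : ∀ j k : Set.Iio i, j < k → (h j).1 ≤ (h k).1 ∧ (h j).2 < (h k).2 :=
      fun j k hjk => ⟨(hund k).1.le_condition ⟨j.1, hjk⟩, (hund k).1.lt_ordinal ⟨j.1, hjk⟩⟩
    by_cases hl : IsSuccLimit i
    · obtain ⟨a, haS, ha⟩ := hsup hl
      -- `δ` is controlled only at the stages of completeness. These are re-enumerated by their
      -- order type, since explicit closure speaks of sequences indexed by an ordinal.
      let T : Set i.ToType := {t | Moves (Ordinal.ToType.mk.symm t).1 Player.completeness}
      let n := Ordinal.enum (α := T) (· < ·)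
      let f : Set.Iio (Ordinal.type (α := T) (· < ·)) → Set.Iio i := fun j =>
        Ordinal.ToType.mk.symm (n j).1
      have hfc : ∀ j, Moves (f j).1 Player.completeness := fun j => (n j).2
      have hf : ∀ j k, j < k → f j < f k := fun j k hjk =>
        Ordinal.ToType.mk.symm.strictMono (n.map_rel_iff.2 hjk)
      have hfs : ∀ k : Set.Iio i, ∃ j, k ≤ f j := by
        intro k
        have : ∃ k', k ≤ k' ∧ Moves k'.1 Player.completeness := by
          rcases moves_or k.1 with hk | hk
          · exact ⟨⟨succ k.1, hl.succ_lt k.2⟩, le_succ k.1, Moves.succ_incompleteness _ hk⟩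
          · exact ⟨k, le_rfl, hk⟩
        obtain ⟨k', hkk', hk'⟩ := this
        refine ⟨n.symm ⟨Ordinal.ToType.mk k', by simpa [T] using hk'⟩, ?_⟩
        simpa [f] using hkk'
      obtain ⟨j0, -⟩ := hfs ⟨0, hl.bot_lt⟩
      obtain ⟨q, hq, hqa⟩ := hδu _ (fun j => (h (f j)).1) (fun h0 => by
          exact not_lt_zero (h0 ▸ Set.mem_Iio.1 j0.2 : j0.1 < 0))
        (fun j k hjk => by
          rcases hjk.lt_or_eq with hjk | rfl
          · exact (hmono _ _ (hf j k hjk)).1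
          · exact le_rfl)
        (fun j k hjk => by
          rw [hδ _ (hfc j), hδ _ (hfc k)]
          exact (hmono _ _ (hf j k hjk)).2) a haS
        ⟨by
          rintro _ ⟨j, rfl⟩
          exact (hδ _ (hfc j)).le.trans (ha.1 ⟨f j, rfl⟩), fun b hb => ha.2 (by
          rintro _ ⟨k, rfl⟩
          obtain ⟨j, hj⟩ := hfs k
          refine le_trans ?_ ((hδ _ (hfc j)).ge.trans (hb ⟨j, rfl⟩))
          rcases hj.lt_or_eq with hj | rfl
          · exact (hmono _ _ hj).2.le
          · exact le_rfl)⟩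
      refine ⟨(q, a), ⟨fun k => ?_, fun k => ?_, fun _ => ha⟩, hqa⟩
      · obtain ⟨j, hj⟩ := hfs k
        refine le_trans ?_ (hq j)
        rcases hj.lt_or_eq with hj | rfl
        · exact (hmono _ _ hj).1
        · exact le_rfl
      · have hk : k < ⟨succ k.1, hl.succ_lt k.2⟩ := lt_succ k.1
        exact (hmono _ _ hk).2.trans_le (ha.1 ⟨_, rfl⟩)
    · obtain ⟨k, rfl⟩ : ∃ k, i = succ k := by
        cases hi with
        | succ_incompleteness k _ => exact ⟨k, rfl⟩
        | limit _ h => exact (hl h).elim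
      let k' : Set.Iio (succ k) := ⟨k, lt_succ k⟩
      obtain ⟨γ, hγ⟩ := hreg.exists_gt_Iio (h k').2
      obtain ⟨q, hq, hkq⟩ := hδd γ (h k').1
      refine ⟨(q, δ q), ⟨fun j => ?_, fun j => ?_, fun hl' => (hl hl').elim⟩, rfl⟩
      · rcases (show j ≤ k' from (lt_succ_iff.1 (Set.mem_Iio.1 j.2) : j.1 ≤ k)).lt_or_eq with hj | hj
        · exact (hmono _ _ hj).1.trans hkq
        · rwa [hj]
      · refine lt_of_le_of_lt ?_ (hγ.trans_le hq)
        rcases (show j ≤ k' from (lt_succ_iff.1 (Set.mem_Iio.1 j.2) : j.1 ≤ k)).lt_or_eq with hj | hj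
        · exact (hmono _ _ hj).2.le
        · rw [hj]
  exact ⟨σ, fun i h _ hi hund hfol hsup => (hσ i h (key i h hi hund hfol hsup)).1⟩

/-! ### Distributivity -/

theorem IsStrategicallyClosed.isDistributiveBelow {lam : Cardinal.{u}} (hreg : lam.IsRegular)
    (hunc : ℵ₀ < lam) (hGCH : GCHBelow lam) {S : Set (Set.Iio lam.ord)} (hS : IsFat S)
    {P : Type u} [Preorder P] (hP : IsStrategicallyClosed S P) : IsDistributiveBelow lam P := by
  have hregular : ∀ (ι : Type u) (U : ι → Set P) (θ : Cardinal.{u}), θ.IsRegular → θ < lam → #ι ≤ θ →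
      (∀ i, IsUpperSet (U i) ∧ IsDenseSubset (U i)) → IsDenseSubset (⋂ i, U i) := by
    intro ι U θ hθ hθl hι hU p
    rw [← mk_ord_toType θ] at hι
    obtain ⟨f⟩ := hι
    let g : ι → Ordinal.{u} := fun i => (Ordinal.ToType.mk.symm (f i)).1
    have hg : Function.Injective g := fun i j h =>
      f.injective (Ordinal.ToType.mk.symm.injective (Subtype.ext h))
    -- Each `U i` is assigned to a successor step, since nothing can be required at limits; being
    -- open, it still contains the last condition.
    obtain ⟨q, s, h0, h1, -, h3⟩ := hP.exists_sequence hreg hunc hGCH hS hθ hθl p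
      (fun j r _ => ∀ i, j = succ (g i) → r ∈ U i) fun j r γ _ => by
        obtain ⟨γ', hγ'⟩ := hreg.exists_gt_Iio γ
        by_cases hj : ∃ i, j = succ (g i)
        · obtain ⟨i, rfl⟩ := hj
          obtain ⟨r', hr', hrr'⟩ := (hU i).2 r
          refine ⟨r', γ', hrr', hγ', fun k hk => ?_⟩
          rwa [← hg (succ_injective hk)]
        · exact ⟨r, γ', le_rfl, hγ', fun i hi => (hj ⟨i, hi⟩).elim⟩
    refine ⟨q θ.ord, Set.mem_iInter.2 fun i => ?_, h0 _ le_rfl⟩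
    have hi : succ (g i) < θ.ord :=
      (isSuccLimit_ord hθ.aleph0_le).succ_lt (Ordinal.ToType.mk.symm (f i)).2
    exact (hU i).1 (h1 _ _ hi le_rfl).1 (h3 _ hi (fun h => h.succ_ne _ rfl) i rfl)
  intro ι
  induction hκ : #ι using WellFoundedLT.induction generalizing ι with
  | ind κ ih =>
  intro U hι hU
  subst hκ
  rcases lt_aleph0_or_isRegular_or_isSingular (c := #ι) with h | h | h
  · exact hregular ι U ℵ₀ isRegular_aleph0 hunc h.le hU
  · exact hregular ι U _ h hι le_rfl hU
  -- No play has singular length. Split the index set into fewer than `#ι` pieces, each smaller than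
  -- `#ι`, and use the induction hypothesis inside each piece and then for the family of pieces.
  · obtain ⟨Z, hZ, hZc⟩ := Order.exists_cof_eq (#ι).ord.ToType
    rw [Ordinal.cof_toType] at hZc
    have hZl : #Z < #ι := hZc ▸ h.cof_ord_lt
    obtain ⟨f⟩ : Nonempty (ι ≃ (#ι).ord.ToType) := Cardinal.eq.1 (by simp)
    have hin : ∀ z : Z, IsDenseSubset (⋂ i : {i // f i ≤ z}, U i.1) := by
      intro z
      have hz : #{i // f i ≤ z} < #ι := by
        have h1 : #(Set.Iic z.1) < #ι := by
          simpa using mk_Iic_lt z.1 (by simp) (by simpa using aleph0_le_of_isSuccLimit h.isSuccLimit)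
        refine (mk_le_of_injective (f := fun i : {i // f i ≤ z} => (⟨f i.1, i.2⟩ : Set.Iic z.1))
          fun i j hij => ?_).trans_lt h1
        exact Subtype.ext (f.injective (congrArg Subtype.val hij))
      exact ih _ hz _ rfl _ (hz.trans hι) fun i => hU i.1
    have := ih _ hZl _ rfl (fun z : Z => ⋂ i : {i // f i ≤ z}, U i.1) (hZl.trans hι)
      fun z => ⟨isUpperSet_iInter fun i => (hU i.1).1, hin z⟩
    refine fun p => ?_
    obtain ⟨q, hq, hpq⟩ := this p
    refine ⟨q, Set.mem_iInter.2 fun i => ?_, hpq⟩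
    obtain ⟨z, hz, hiz⟩ := hZ (f i)
    exact Set.mem_iInter.1 (Set.mem_iInter.1 hq ⟨z, hz⟩) ⟨i, hiz⟩

/-! ### Forcing equality and membership -/

namespace PName

variable {P : Type u} [Preorder P]

theorem forcesEq_mk {ι κ : Type u} {a : ι → PName P} {r : ι → P} {b : κ → PName P} {s : κ → P} {p : P} :
    forcesEq (mk ι a r) (mk κ b s) p ↔
    (∀ i q, p ≤ q → r i ≤ q → ∃ q', q ≤ q' ∧ ∃ j, s j ≤ q' ∧ forcesEq (a i) (b j) q') ∧
    (∀ j q, p ≤ q → s j ≤ q → ∃ q', q ≤ q' ∧ ∃ i, r i ≤ q' ∧ forcesEq (a i) (b j) q') := by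
  rw [forcesEq]

theorem forcesEq.mono {a b : PName P} {p q : P} (h : forcesEq a b p) (hpq : p ≤ q) :
    forcesEq a b q := by
  cases a; cases b
  rw [forcesEq_mk] at h ⊢
  exact ⟨fun i q' hq => h.1 i q' (hpq.trans hq), fun i q' hq => h.2 i q' (hpq.trans hq)⟩

/-- The definition already asks for its witnesses only in some extension. This permits passing to
conditions that decide names. -/
theorem forcesEq.of_dense {a b : PName P} {p : P} (h : ∀ q, p ≤ q → ∃ r, q ≤ r ∧ forcesEq a b r) :
    forcesEq a b p := by
  cases a; cases b
  rw [forcesEq_mk]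
  constructor
  · intro i q hpq hiq
    obtain ⟨r, hqr, hr⟩ := h q hpq
    obtain ⟨q', hq', h'⟩ := (forcesEq_mk.1 hr).1 i r le_rfl (hiq.trans hqr)
    exact ⟨q', hqr.trans hq', h'⟩
  · intro i q hpq hiq
    obtain ⟨r, hqr, hr⟩ := h q hpq
    obtain ⟨q', hq', h'⟩ := (forcesEq_mk.1 hr).2 i r le_rfl (hiq.trans hqr)
    exact ⟨q', hqr.trans hq', h'⟩

theorem forcesEq.refl (a : PName P) (p : P) : forcesEq a a p := by
  induction a generalizing p with
  | mk ι a r ih =>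
    rw [forcesEq_mk]
    exact ⟨fun i q _ hq => ⟨q, le_rfl, i, hq, ih i q⟩, fun i q _ hq => ⟨q, le_rfl, i, hq, ih i q⟩⟩

theorem forcesEq.symm {a b : PName P} {p : P} (h : forcesEq a b p) : forcesEq b a p := by
  induction a generalizing b p with
  | mk ι a r ih =>
    cases b
    rw [forcesEq_mk] at h ⊢
    constructor
    · intro j q hpq hq
      obtain ⟨q', hq', i, hi, hij⟩ := h.2 j q hpq hq
      exact ⟨q', hq', i, hi, ih i hij⟩
    · intro j q hpq hq
      obtain ⟨q', hq', i, hi, hij⟩ := h.1 j q hpq hq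
      exact ⟨q', hq', i, hi, ih j hij⟩

theorem forcesEq.trans {a b c : PName P} {p : P} (h : forcesEq a b p) (h' : forcesEq b c p) :
    forcesEq a c p := by
  induction a generalizing b c p with
  | mk ι a r ih =>
    cases b; cases c
    rw [forcesEq_mk] at h h' ⊢
    constructor
    · intro i q hpq hq
      obtain ⟨q1, hq1, j, hj, hij⟩ := h.1 i q hpq hq
      obtain ⟨q2, hq2, k, hk, hjk⟩ := h'.1 j q1 (hpq.trans hq1) hj
      exact ⟨q2, hq1.trans hq2, k, hk, ih i (hij.mono hq2) hjk⟩
    · intro k q hpq hq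
      obtain ⟨q1, hq1, j, hj, hjk⟩ := h'.2 k q hpq hq
      obtain ⟨q2, hq2, i, hi, hij⟩ := h.2 j q1 (hpq.trans hq1) hj
      exact ⟨q2, hq1.trans hq2, i, hi, ih i hij (hjk.mono hq2)⟩

theorem forcesMem_mk {a : PName P} {κ : Type u} {b : κ → PName P} {s : κ → P} {p : P} :
    forcesMem a (mk κ b s) p ↔ ∀ q, p ≤ q → ∃ r, q ≤ r ∧ ∃ j, s j ≤ r ∧ forcesEq a (b j) r :=
  Iff.rfl

theorem forcesMem.mono {a b : PName P} {p q : P} (h : forcesMem a b p) (hpq : p ≤ q) :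
    forcesMem a b q := by
  cases b
  exact fun q' hq' => h q' (hpq.trans hq')

theorem forcesMem.of_dense {a b : PName P} {p : P} (h : ∀ q, p ≤ q → ∃ r, q ≤ r ∧ forcesMem a b r) :
    forcesMem a b p := by
  cases b
  intro q hq
  obtain ⟨r, hqr, hr⟩ := h q hq
  obtain ⟨r', hr', h'⟩ := hr r le_rfl
  exact ⟨r', hqr.trans hr', h'⟩

theorem forcesMem.congr_left {a a' b : PName P} {p : P} (h : forcesMem a b p)
    (he : forcesEq a a' p) : forcesMem a' b p := by
  cases b
  intro q hq
  obtain ⟨r, hqr, j, hj, hr⟩ := h q hq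
  exact ⟨r, hqr, j, hj, (he.mono (hq.trans hqr)).symm.trans hr⟩

theorem forcesMem.congr_right {a b b' : PName P} {p : P} (h : forcesMem a b p)
    (he : forcesEq b b' p) : forcesMem a b' p := by
  cases b; cases b'
  intro q hq
  obtain ⟨r, hqr, j, hj, hr⟩ := h q hq
  obtain ⟨r', hr', k, hk, hjk⟩ := (forcesEq_mk.1 he).1 j r (hq.trans hqr) hj
  exact ⟨r', hqr.trans hr', k, hk, (hr.mono hr').trans hjk⟩

/-! ### Canonical names -/

theorem forcesEq_check_of_equiv {a b : PSet.{u}} (h : PSet.Equiv a b) (p : P) :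
    forcesEq (check a) (check b) p := by
  induction a generalizing b p with
  | mk α A ih =>
    cases b with
    | mk β B =>
      rw [check, check, forcesEq_mk]
      constructor
      · rintro ⟨i, s⟩ q - -
        obtain ⟨j, hj⟩ := h.1 i
        exact ⟨q, le_rfl, (j, q), le_rfl, ih i hj q⟩
      · rintro ⟨j, s⟩ q - -
        obtain ⟨i, hi⟩ := h.2 j
        exact ⟨q, le_rfl, (i, q), le_rfl, ih i hi q⟩

theorem equiv_of_forcesEq_check {a b : PSet.{u}} {p : P} (h : forcesEq (check a) (check b) p) :
    PSet.Equiv a b := by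
  induction a generalizing b p with
  | mk α A ih =>
    cases b with
    | mk β B =>
      rw [check, check, forcesEq_mk] at h
      constructor
      · intro i
        obtain ⟨q, -, j, -, hj⟩ := h.1 (i, p) p le_rfl le_rfl
        exact ⟨j.1, ih i hj⟩
      · intro j
        obtain ⟨q, -, i, -, hi⟩ := h.2 (j, p) p le_rfl le_rfl
        exact ⟨i.1, ih i.1 hi⟩

theorem forcesMem_check_iff {x : PName P} {a : PSet.{u}} {p : P} :
    forcesMem x (check a) p ↔ ∀ q, p ≤ q → ∃ r, q ≤ r ∧ ∃ c ∈ a, forcesEq x (check c) r := by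
  cases a with
  | mk α A =>
    rw [check, forcesMem_mk]
    refine forall₂_congr fun q _ => exists_congr fun r => and_congr_right fun _ => ?_
    constructor
    · rintro ⟨i, -, hi⟩
      exact ⟨_, PSet.Mem.mk A i.1, hi⟩
    · rintro ⟨c, ⟨i, hi⟩, hc⟩
      exact ⟨(i, r), le_rfl, hc.trans (forcesEq_check_of_equiv hi r)⟩

theorem forcesMem_check_of_mem {a b : PSet.{u}} (h : a ∈ b) (p : P) :
    forcesMem (check a) (check b) p :=
  forcesMem_check_iff.2 fun q _ => ⟨q, le_rfl, a, h, forcesEq.refl _ q⟩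

/-- The canonical name of an ordinal. -/
noncomputable abbrev ord (P : Type u) (α : Ordinal.{u}) : PName P := check (Ordinal.toPSet α)

theorem forcesMem_ord_iff {x : PName P} {α : Ordinal.{u}} {p : P} :
    forcesMem x (ord P α) p ↔ ∀ q, p ≤ q → ∃ r, q ≤ r ∧ ∃ β < α, forcesEq x (ord P β) r := by
  rw [forcesMem_check_iff]
  refine forall₂_congr fun q _ => exists_congr fun r => and_congr_right fun _ => ?_
  constructor
  · rintro ⟨c, hc, hx⟩
    obtain ⟨β, hβ, hcβ⟩ := Ordinal.mem_toPSet_iff.1 hc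
    exact ⟨β, hβ, hx.trans (forcesEq_check_of_equiv hcβ r)⟩
  · rintro ⟨β, hβ, hx⟩
    exact ⟨_, Ordinal.mem_toPSet_iff.2 ⟨β, hβ, PSet.Equiv.rfl⟩, hx⟩

theorem equiv_toPSet_iff {α β : Ordinal.{u}} :
    PSet.Equiv α.toPSet β.toPSet ↔ α = β := by
  constructor
  · intro h
    rw [← Ordinal.rank_toPSet α, ← Ordinal.rank_toPSet β]
    exact PSet.rank_congr h
  · rintro rfl
    exact PSet.Equiv.rfl

theorem eq_of_forcesEq_ord {α β : Ordinal.{u}} {p : P} (h : forcesEq (ord P α) (ord P β) p) :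
    α = β :=
  equiv_toPSet_iff.1 (equiv_of_forcesEq_check h)

theorem forcesMem_ord {α β : Ordinal.{u}} (h : α < β) (p : P) : forcesMem (ord P α) (ord P β) p :=
  forcesMem_check_of_mem (Ordinal.mem_toPSet_iff.2 ⟨α, h, PSet.Equiv.rfl⟩) p

theorem lt_of_forcesMem_ord {α β : Ordinal.{u}} {p : P} (h : forcesMem (ord P α) (ord P β) p) :
    α < β := by
  obtain ⟨r, -, γ, hγ, hr⟩ := forcesMem_ord_iff.1 h p le_rfl
  rwa [eq_of_forcesEq_ord hr]

theorem mem_subsetToPSet_iff {lam : Cardinal.{u}} {S : Set (Set.Iio lam.ord)} {x : PSet.{u}} :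
    x ∈ subsetToPSet S ↔ ∃ α ∈ S, PSet.Equiv x (Ordinal.toPSet α.1) := by
  rw [subsetToPSet, PSet.mem_sep]
  · refine and_iff_right_of_imp ?_
    rintro ⟨α, -, hα⟩
    exact Ordinal.mem_toPSet_iff.2 ⟨α.1, α.2, hα⟩
  · rintro x y hxy ⟨α, hα, hx⟩
    exact ⟨α, hα, hxy.symm.trans hx⟩

theorem forcesMem_subset_iff {lam : Cardinal.{u}} {S : Set (Set.Iio lam.ord)} {x : PName P} {p : P} :
    forcesMem x (check (subsetToPSet S)) p ↔
      ∀ q, p ≤ q → ∃ r, q ≤ r ∧ ∃ α ∈ S, forcesEq x (ord P α.1) r := by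
  rw [forcesMem_check_iff]
  refine forall₂_congr fun q _ => exists_congr fun r => and_congr_right fun _ => ?_
  constructor
  · rintro ⟨c, hc, hx⟩
    obtain ⟨α, hα, hcα⟩ := mem_subsetToPSet_iff.1 hc
    exact ⟨α, hα, hx.trans (forcesEq_check_of_equiv hcα r)⟩
  · rintro ⟨α, hα, hx⟩
    exact ⟨_, mem_subsetToPSet_iff.2 ⟨α, hα, PSet.Equiv.rfl⟩, hx⟩

end PName

/-! ### Forcing statements about pairs and functions -/

namespace ForcingStatement

open PName

variable {P : Type u} [Preorder P]

theorem isUnorderedPair.mono {z x y : PName P} {p q : P} (h : isUnorderedPair z x y p) (hpq : p ≤ q) :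
    isUnorderedPair z x y q :=
  fun w => ⟨fun r hr => (h w).1 r (hpq.trans hr), fun r hr => (h w).2 r (hpq.trans hr)⟩

theorem isUnorderedPair.left_mem {z x y : PName P} {p : P} (h : isUnorderedPair z x y p) :
    forcesMem x z p :=
  (h x).2 p le_rfl fun q _ => ⟨q, le_rfl, Or.inl (forcesEq.refl x q)⟩

theorem isUnorderedPair.right_mem {z x y : PName P} {p : P} (h : isUnorderedPair z x y p) :
    forcesMem y z p :=
  (h y).2 p le_rfl fun q _ => ⟨q, le_rfl, Or.inr (forcesEq.refl y q)⟩

theorem isUnorderedPair.cases {z x y w : PName P} {p : P} (h : isUnorderedPair z x y p)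
    (hw : forcesMem w z p) : ∃ r, p ≤ r ∧ (forcesEq w x r ∨ forcesEq w y r) :=
  (h w).1 p le_rfl hw p le_rfl

theorem isUnorderedPair.cases_singleton {z x w : PName P} {p : P} (h : isUnorderedPair z x x p)
    (hw : forcesMem w z p) : forcesEq w x p :=
  forcesEq.of_dense fun q hq => by
    obtain ⟨r, hr, h'⟩ := (h.mono hq).cases (hw.mono hq)
    exact ⟨r, hr, h'.elim id id⟩

/-- The usual case analysis for Kuratowski pairs. A forced disjunction is decided only in an
extension, so the equalities are first shown on a dense set. -/
theorem isPair.injective {z x y x' y' : PName P} {p : P} (h : isPair z x y p)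
    (h' : isPair z x' y' p) : forcesEq x x' p ∧ forcesEq y y' p := by
  have key : ∀ q, p ≤ q → ∃ r, q ≤ r ∧ forcesEq x x' r ∧ forcesEq y y' r := by
    intro q hq
    obtain ⟨r1, hr1, v, hv⟩ := h q hq
    obtain ⟨r2, hr2, w, hvx, hwx, hzv⟩ := hv r1 le_rfl
    obtain ⟨r3, hr3, v', hv'⟩ := h' r2 (hq.trans (hr1.trans hr2))
    obtain ⟨r, hr4, w', hvx', hwx', hzv'⟩ := hv' r3 le_rfl
    have hr24 := hr3.trans hr4
    replace hvx := isUnorderedPair.mono hvx hr24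
    replace hwx := isUnorderedPair.mono hwx hr24
    replace hzv := isUnorderedPair.mono hzv hr24
    have hqr : q ≤ r := hr1.trans (hr2.trans hr24)
    have hx : forcesEq x x' r := by
      refine forcesEq.of_dense fun s hs => ?_
      obtain ⟨t, hst, ht | ht⟩ := (isUnorderedPair.mono hzv' hs).cases (hzv.left_mem.mono hs)
      · exact ⟨t, hst, (isUnorderedPair.mono hvx' (hs.trans hst)).cases_singleton
          ((hvx.left_mem.mono (hs.trans hst)).congr_right ht)⟩
      · exact ⟨t, hst, ((isUnorderedPair.mono hvx (hs.trans hst)).cases_singleton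
          (((isUnorderedPair.left_mem hwx').mono (hs.trans hst)).congr_right ht.symm)).symm⟩
    obtain ⟨s, hs, hw⟩ := isUnorderedPair.cases hzv' hzv.right_mem
    rcases hw with hw | hw
    · have hyx' := (isUnorderedPair.mono hvx' hs).cases_singleton ((hwx.right_mem.mono hs).congr_right hw)
      obtain ⟨t, ht, hw' | hw'⟩ := (hzv.mono hs).cases ((isUnorderedPair.right_mem hzv').mono hs)
      · have hst := hs.trans ht
        have hy'x := (hvx.mono hst).cases_singleton
          (((isUnorderedPair.right_mem hwx').mono hst).congr_right hw')
        exact ⟨t, hqr.trans hst, hx.mono hst,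
          (hyx'.mono ht).trans ((hx.mono hst).symm.trans hy'x.symm)⟩
      · have hst := hs.trans ht
        obtain ⟨u, hu, hy' | hy'⟩ := (hwx.mono hst).cases
          (((isUnorderedPair.right_mem hwx').mono hst).congr_right hw')
        · have htu := hst.trans hu
          exact ⟨u, hqr.trans htu, hx.mono htu,
            (hyx'.mono (ht.trans hu)).trans ((hx.mono htu).symm.trans hy'.symm)⟩
        · exact ⟨u, hqr.trans (hst.trans hu), hx.mono (hst.trans hu), hy'.symm⟩
    · obtain ⟨t, ht, hy | hy⟩ := (isUnorderedPair.mono hwx' hs).cases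
        ((hwx.right_mem.mono hs).congr_right hw)
      · have hst := hs.trans ht
        obtain ⟨u, hu, hy' | hy'⟩ := (hwx.mono hst).cases
          (((isUnorderedPair.right_mem hwx').mono hst).congr_right (hw.mono ht).symm)
        · have htu := hst.trans hu
          exact ⟨u, hqr.trans htu, hx.mono htu,
            (hy.mono hu).trans ((hx.mono htu).symm.trans hy'.symm)⟩
        · exact ⟨u, hqr.trans (hst.trans hu), hx.mono (hst.trans hu), hy'.symm⟩
      · exact ⟨t, hqr.trans (hs.trans ht), hx.mono (hs.trans ht), hy⟩
  constructor
  · exact forcesEq.of_dense fun q hq => by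
      obtain ⟨r, hr, h1, -⟩ := key q hq
      exact ⟨r, hr, h1⟩
  · exact forcesEq.of_dense fun q hq => by
      obtain ⟨r, hr, -, h2⟩ := key q hq
      exact ⟨r, hr, h2⟩

theorem isUnorderedPair_check {a b : PSet.{u}} {x y : PName P} {p : P}
    (hx : forcesEq x (check a) p) (hy : forcesEq y (check b) p) :
    isUnorderedPair (check {a, b}) x y p := by
  refine fun w => ⟨fun q hq hw q' hq' => ?_, fun q hq hw => ?_⟩
  · obtain ⟨r, hr, c, hc, hwc⟩ := forcesMem_check_iff.1 hw q' hq'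
    have hpr : p ≤ r := hq.trans (hq'.trans hr)
    refine ⟨r, hr, (PSet.mem_pair.1 hc).imp (fun h => ?_) fun h => ?_⟩
    · exact hwc.trans ((forcesEq_check_of_equiv h r).trans (hx.mono hpr).symm)
    · exact hwc.trans ((forcesEq_check_of_equiv h r).trans (hy.mono hpr).symm)
  · refine forcesMem_check_iff.2 fun q' hq' => ?_
    obtain ⟨r, hr, h⟩ := hw q' hq'
    have hpr : p ≤ r := hq.trans (hq'.trans hr)
    rcases h with h | h
    · exact ⟨r, hr, a, PSet.mem_pair.2 (Or.inl PSet.Equiv.rfl), forcesEq.trans h (hx.mono hpr)⟩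
    · exact ⟨r, hr, b, PSet.mem_pair.2 (Or.inr PSet.Equiv.rfl), forcesEq.trans h (hy.mono hpr)⟩

/-- The Kuratowski pair of two sets. -/
def kuratowskiPair (a b : PSet.{u}) : PSet.{u} := {{a, a}, {a, b}}

theorem isPair_check {a b : PSet.{u}} {x y : PName P} {p : P}
    (hx : forcesEq x (check a) p) (hy : forcesEq y (check b) p) :
    isPair (check (kuratowskiPair a b)) x y p := by
  refine fun q hq => ⟨q, le_rfl, check {a, a}, fun r hr => ⟨r, le_rfl, check {a, b}, ?_, ?_, ?_⟩⟩
  · exact isUnorderedPair_check (hx.mono (hq.trans hr)) (hx.mono (hq.trans hr))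
  · exact isUnorderedPair_check (hx.mono (hq.trans hr)) (hy.mono (hq.trans hr))
  · exact isUnorderedPair_check (forcesEq.refl _ r) (forcesEq.refl _ r)

theorem isPair.congr {z z' x y : PName P} {p : P} (h : isPair z x y p) (hz : forcesEq z z' p) :
    isPair z' x y p := by
  intro q hq
  obtain ⟨r, hr, v, hv⟩ := h q hq
  refine ⟨r, hr, v, fun q' hq' => ?_⟩
  obtain ⟨r', hr', w, h1, h2, h3⟩ := hv q' hq'
  refine ⟨r', hr', w, h1, h2, fun t => ⟨fun s hs ht => ?_, fun s hs ht => ?_⟩⟩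
  · have : p ≤ s := hq.trans (hr.trans (hq'.trans (hr'.trans hs)))
    exact (h3 t).1 s hs (forcesMem.congr_right ht (hz.mono this).symm)
  · have : p ≤ s := hq.trans (hr.trans (hq'.trans (hr'.trans hs)))
    exact forcesMem.congr_right ((h3 t).2 s hs ht) (hz.mono this)

theorem isPair.mono {z x y : PName P} {p q : P} (h : isPair z x y p) (hpq : p ≤ q) :
    isPair z x y q :=
  fun r hr => h r (hpq.trans hr)

/-- The graph of the function that sends `A i` to `B i`. -/
def graph {ι : Type u} (A B : ι → PSet.{u}) : PSet.{u} :=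
  ⟨ι, fun i => kuratowskiPair (A i) (B i)⟩

theorem maps_graph_iff {ι : Type u} {A B : ι → PSet.{u}} {x y : PName P} {p : P} :
    maps (check (graph A B)) x y p ↔
      ∀ q, p ≤ q → ∃ r, q ≤ r ∧ ∃ i, forcesEq x (check (A i)) r ∧ forcesEq y (check (B i)) r := by
  constructor
  · intro h q hq
    obtain ⟨r, hr, z, hz, hzxy⟩ := h q hq
    obtain ⟨r', hr', c, ⟨i, hi⟩, hzc⟩ := forcesMem_check_iff.1 hz r le_rfl
    refine ⟨r', hr.trans hr', i, isPair.injective (z := check (kuratowskiPair (A i) (B i))) ?_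
      (isPair_check (forcesEq.refl _ _) (forcesEq.refl _ _))⟩
    exact (isPair.mono hzxy hr').congr (hzc.trans (forcesEq_check_of_equiv hi r'))
  · intro h q hq
    obtain ⟨r, hr, i, hx, hy⟩ := h q hq
    exact ⟨r, hr, check (kuratowskiPair (A i) (B i)), forcesMem_check_of_mem
      (PSet.Mem.mk (fun i => kuratowskiPair (A i) (B i)) i) r, isPair_check hx hy⟩

theorem maps_graph {ι : Type u} (A B : ι → PSet.{u}) (i : ι) (p : P) :
    maps (check (graph A B)) (check (A i)) (check (B i)) p :=
  maps_graph_iff.2 fun q _ => ⟨q, le_rfl, i, forcesEq.refl _ q, forcesEq.refl _ q⟩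

theorem isFunction_graph {ι : Type u} {A B : ι → PSet.{u}} {a b : PName P} {p : P}
    (hA : ∀ i, forcesMem (check (A i)) a p) (hB : ∀ i, forcesMem (check (B i)) b p)
    (hdom : ∀ x q, p ≤ q → forcesMem x a q → ∃ r, q ≤ r ∧ ∃ i, forcesEq x (check (A i)) r)
    (hAB : ∀ i j, PSet.Equiv (A i) (A j) → PSet.Equiv (B i) (B j)) :
    isFunction (check (graph A B)) a b p := by
  refine ⟨fun z q hq hz q' hq' => ?_, fun x q hq hx q' hq' => ?_, fun x y y' q hq hxy q' hq' hxy' => ?_⟩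
  · obtain ⟨r, hr, c, ⟨i, hi⟩, hzc⟩ := forcesMem_check_iff.1 hz q' hq'
    have hpr : p ≤ r := hq.trans (hq'.trans hr)
    refine ⟨r, hr, check (A i), (hA i).mono hpr, fun s hs => ⟨s, le_rfl, check (B i),
      (hB i).mono (hpr.trans hs), ?_⟩⟩
    exact (isPair_check (forcesEq.refl _ _) (forcesEq.refl _ _)).congr
      ((hzc.mono hs).trans (forcesEq_check_of_equiv hi s)).symm
  · obtain ⟨r, hr, i, hi⟩ := hdom x q' (hq.trans hq') (forcesMem.mono hx hq')
    exact ⟨r, hr, check (B i), (hB i).mono (hq.trans (hq'.trans hr)), maps_graph_iff.2 fun s hs =>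
      ⟨s, le_rfl, i, hi.mono hs, forcesEq.refl _ s⟩⟩
  · refine forcesEq.of_dense fun s hs => ?_
    obtain ⟨r, hr, i, hxi, hyi⟩ := maps_graph_iff.1 hxy s (hq'.trans hs)
    obtain ⟨r', hr', j, hxj, hyj⟩ := maps_graph_iff.1 hxy' r (hs.trans hr)
    refine ⟨r', hr.trans hr', (hyi.mono hr').trans (forcesEq.trans ?_ hyj.symm)⟩
    exact forcesEq_check_of_equiv
      (hAB i j (equiv_of_forcesEq_check ((hxi.mono hr').symm.trans hxj))) r'

end ForcingStatement

/-! ### Regular cardinals, clubs and closed sets of ordinals in the extension -/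

namespace ForcingStatement

open PName

variable {P : Type u} [Preorder P]

/-- Regularity goes down to the ground model: the canonical name of a cofinal map from a smaller
ordinal would still be an unbounded function. -/
theorem exists_isRegular_of_isRegular {x : PName P} {α : Ordinal.{u}} {p : P}
    (hx : forcesEq x (PName.ord P α) p) (h : isRegular x p) :
    ∃ θ : Cardinal.{u}, θ.IsRegular ∧ α = θ.ord := by
  obtain ⟨h0, hs, hf⟩ := h
  have hmem : ∀ β < α, ∀ q, p ≤ q → forcesMem (PName.ord P β) x q := fun β hβ q hq =>
    (forcesMem_ord hβ q).congr_right (hx.mono hq).symm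
  have hdec : ∀ y q, p ≤ q → forcesMem y x q → ∃ r, q ≤ r ∧ ∃ β < α, forcesEq y (PName.ord P β) r :=
    fun y q hq hy => forcesMem_ord_iff.1 (hy.congr_right (hx.mono hq)) q le_rfl
  have hα0 : α ≠ 0 := by
    rintro rfl
    obtain ⟨r, hr, y, hy⟩ := h0 p le_rfl
    obtain ⟨r', -, β, hβ, -⟩ := hdec y r hr hy
    exact not_lt_zero hβ
  have hlim : IsSuccLimit α := by
    rcases Ordinal.zero_or_succ_or_isSuccLimit α with h | ⟨β, rfl⟩ | h
    · exact (hα0 h).elim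
    · exfalso
      have hβ : β < β + 1 := lt_add_one β
      obtain ⟨r, hr, y, hy, hβy⟩ := hs _ p le_rfl (hmem β hβ p le_rfl) p le_rfl
      obtain ⟨r', hr', γ, hγ, hyγ⟩ := hdec y r hr hy
      have := lt_of_forcesMem_ord ((forcesMem.mono hβy hr').congr_right hyγ)
      exact (lt_succ_iff.1 hγ).not_gt this
    · exact h
  have hcof : α.cof.ord = α := by
    refine le_antisymm (Ordinal.ord_cof_le α) (le_of_not_gt fun hlt => ?_)
    obtain ⟨Z, hZ, hZc⟩ := Order.exists_cof_eq α.ToType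
    rw [Ordinal.cof_toType] at hZc
    obtain ⟨e⟩ : Nonempty (α.cof.ord.ToType ≃ Z) := Cardinal.eq.1 (by simpa using hZc.symm)
    let A : α.cof.ord.ToType → PSet.{u} := fun i => (Ordinal.ToType.mk.symm i).1.toPSet
    let B : α.cof.ord.ToType → PSet.{u} := fun i => (Ordinal.ToType.mk.symm (e i).1).1.toPSet
    have hfun : isFunction (check (graph A B)) (PName.ord P α.cof.ord) x p := by
      refine isFunction_graph (fun i => forcesMem_ord (Ordinal.ToType.mk.symm i).2 p)
        (fun i => hmem _ (Ordinal.ToType.mk.symm (e i).1).2 p le_rfl) (fun y q _ hy => ?_)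
        fun i j hij => ?_
      · obtain ⟨r, hr, β, hβ, hyβ⟩ := forcesMem_ord_iff.1 hy q le_rfl
        exact ⟨r, hr, Ordinal.ToType.mk ⟨β, hβ⟩, by simpa [A] using hyβ⟩
      · rw [Ordinal.ToType.mk.symm.injective (Subtype.ext (equiv_toPSet_iff.1 hij))]
    obtain ⟨r, hr, b, hb, hbd⟩ := hf _ p le_rfl (hmem _ hlt p le_rfl) _ p le_rfl hfun p le_rfl
    obtain ⟨r', hr', γ, hγ, hbγ⟩ := hdec b r hr hb
    obtain ⟨z, hz, hγz⟩ := hZ (Ordinal.ToType.mk ⟨γ, hγ⟩)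
    have h1 := hbd _ _ r' hr' (maps_graph A B (e.symm ⟨z, hz⟩) r')
    have h2 : (Ordinal.ToType.mk.symm z).1 < γ := by
      have := lt_of_forcesMem_ord (forcesMem.congr_right h1 hbγ)
      simpa using this
    have h3 : (⟨γ, hγ⟩ : Set.Iio α) ≤ Ordinal.ToType.mk.symm z :=
      (OrderIso.le_symm_apply _).2 hγz
    exact h2.not_ge h3
  exact ⟨α.cof, Cardinal.isRegular_cof hlim, hcof.symm⟩

theorem isRegular.mono {x : PName P} {p q : P} (h : isRegular x p) (hpq : p ≤ q) : isRegular x q :=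
  ⟨fun r hr => h.1 r (hpq.trans hr), fun y r hr => h.2.1 y r (hpq.trans hr),
    fun y r hr => h.2.2 y r (hpq.trans hr)⟩

theorem isClub.mono {C l : PName P} {p q : P} (h : isClub C l p) (hpq : p ≤ q) : isClub C l q :=
  ⟨fun y r hr => h.1 y r (hpq.trans hr), fun y r hr => h.2.1 y r (hpq.trans hr),
    fun y r hr => h.2.2 y r (hpq.trans hr)⟩

theorem isClub.exists_mem {lam : Ordinal.{u}} {C : PName P} {p : P}
    (h : isClub C (PName.ord P lam) p) {q : P} (hq : p ≤ q) {γ : Ordinal.{u}} (hγ : γ < lam) :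
    ∃ r, q ≤ r ∧ ∃ β, γ < β ∧ β < lam ∧ forcesMem (PName.ord P β) C r := by
  obtain ⟨hsub, hunb, -⟩ := h
  obtain ⟨r, hr, y, hy, hγy⟩ := hunb _ q hq (forcesMem_ord hγ q) q le_rfl
  obtain ⟨r', hr', β, hβ, hyβ⟩ := forcesMem_ord_iff.1 (hsub y r (hq.trans hr) hy) r le_rfl
  exact ⟨r', hr.trans hr', β, lt_of_forcesMem_ord ((forcesMem.mono hγy hr').congr_right hyβ), hβ,
    (forcesMem.mono hy hr').congr_left hyβ⟩

/-- Any name for an element of `δ` is densely equal to a ground model ordinal, so unboundedness need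
only be tested on those. -/
theorem isClub.mem_of_unbounded {lam : Ordinal.{u}} {C : PName P} {p : P}
    (h : isClub C (PName.ord P lam) p) {r : P} (hr : p ≤ r) {δ : Ordinal.{u}} (hδ : δ < lam)
    (hδ0 : 0 < δ) (hunb : ∀ γ < δ, ∃ β, γ < β ∧ β < δ ∧ forcesMem (PName.ord P β) C r) :
    forcesMem (PName.ord P δ) C r := by
  refine h.2.2 _ r hr (forcesMem_ord hδ r) r le_rfl
    (fun q hq => ⟨q, le_rfl, _, forcesMem_ord hδ0 q⟩) r le_rfl fun x q hq hx q' hq' => ?_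
  obtain ⟨s, hs, γ, hγ, hxγ⟩ := forcesMem_ord_iff.1 hx q' hq'
  obtain ⟨β, hγβ, hβδ, hβ⟩ := hunb γ hγ
  exact ⟨s, hs, _, hβ.mono (hq.trans (hq'.trans hs)), forcesMem_ord hβδ s,
    (forcesMem_ord hγβ s).congr_left hxγ.symm⟩

/-- Once an extension decides the limit point, its being a limit of `D` concerns only ground model
ordinals and so holds in the ground model. -/
theorem isClosedIn_check {lam : Cardinal.{u}} {D : Set (Set.Iio lam.ord)}
    (hD : ∀ β : Set.Iio lam.ord, (0 : Ordinal.{u}) < β.1 → (∀ γ < β, ∃ d ∈ D, γ < d ∧ d < β) → β ∈ D)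
    (p : P) : isClosedIn (check (subsetToPSet D)) (PName.ord P lam.ord) p := by
  intro x q hq hx q1 hq1 hne q2 hq2 hunb
  refine forcesMem.of_dense fun q3 hq3 => ?_
  have h13 := hq2.trans hq3
  obtain ⟨r, hr, β, hβ, hxβ⟩ := forcesMem_ord_iff.1 hx q3 (hq1.trans h13)
  refine ⟨r, hr, forcesMem.congr_left (forcesMem_check_of_mem
    (mem_subsetToPSet_iff.2 ⟨⟨β, hβ⟩, hD ⟨β, hβ⟩ ?_ ?_, PSet.Equiv.rfl⟩) r) hxβ.symm⟩
  · obtain ⟨r1, hr1, y, hy⟩ := hne r (h13.trans hr)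
    obtain ⟨r2, hr2, γ, hγ, -⟩ :=
      forcesMem_ord_iff.1 (forcesMem.congr_right hy (hxβ.mono hr1)) r1 le_rfl
    exact lt_of_le_of_lt zero_le hγ
  · intro γ hγ
    have hγx : forcesMem (PName.ord P γ.1) x r := (forcesMem_ord hγ r).congr_right hxβ.symm
    obtain ⟨r1, hr1, y, hy, hyx, hγy⟩ := hunb _ r (hq3.trans hr) hγx r le_rfl
    obtain ⟨r2, hr2, d, hd, hyd⟩ := forcesMem_subset_iff.1 hy r1 le_rfl
    refine ⟨d, hd, ?_, ?_⟩
    · exact lt_of_forcesMem_ord ((forcesMem.mono hγy hr2).congr_right hyd)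
    · exact lt_of_forcesMem_ord (((forcesMem.mono hyx hr2).congr_left hyd).congr_right
        (hxβ.mono (hr1.trans hr2)))

theorem hasOrderTypeSucc_check {lam : Cardinal.{u}} {θ : Ordinal.{u}}
    {s : Ordinal.{u} → Set.Iio lam.ord} (hs : ∀ i j, i < j → j ≤ θ → s i < s j) {x : PName P} {p : P}
    (hx : forcesEq x (PName.ord P θ) p) :
    hasOrderTypeSucc (check (subsetToPSet (s '' Set.Iic θ))) x p := by
  let A : (succ θ).ToType → PSet.{u} := fun i => (Ordinal.ToType.mk.symm i).1.toPSet
  let B : (succ θ).ToType → PSet.{u} := fun i => (s (Ordinal.ToType.mk.symm i).1).1.toPSet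
  have hle : ∀ i : (succ θ).ToType, (Ordinal.ToType.mk.symm i).1 ≤ θ := fun i =>
    lt_succ_iff.1 (Ordinal.ToType.mk.symm i).2
  have hBmem : ∀ i, B i ∈ subsetToPSet (s '' Set.Iic θ) := fun i =>
    mem_subsetToPSet_iff.2 ⟨_, Set.mem_image_of_mem s (hle i), PSet.Equiv.rfl⟩
  intro q hq
  refine ⟨q, le_rfl, PName.ord P (succ θ), fun q' hq' => ⟨q', le_rfl, check (graph A B),
    ?_, ?_, ?_, ?_⟩⟩
  · have hpq : p ≤ q' := hq.trans hq'
    refine fun w => ⟨fun r hr hw r1 hr1 => ?_, fun r hr hw => ?_⟩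
    · obtain ⟨r2, hr2, β, hβ, hwβ⟩ := forcesMem_ord_iff.1 hw r1 hr1
      have hx2 := hx.mono (hpq.trans (hr.trans (hr1.trans hr2)))
      refine ⟨r2, hr2, ?_⟩
      rcases (lt_succ_iff.1 hβ).lt_or_eq with h | rfl
      · exact Or.inl (((forcesMem_ord h r2).congr_left hwβ.symm).congr_right hx2.symm)
      · exact Or.inr (hwβ.trans hx2.symm)
    · refine forcesMem.of_dense fun r1 hr1 => ?_
      obtain ⟨r2, hr2, h⟩ := hw r1 hr1
      have hx2 := hx.mono (hpq.trans (hr.trans (hr1.trans hr2)))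
      rcases h with h | h
      · obtain ⟨r3, hr3, β, hβ, hwβ⟩ := forcesMem_ord_iff.1 (forcesMem.congr_right h hx2) r2 le_rfl
        exact ⟨r3, hr2.trans hr3, (forcesMem_ord (hβ.trans (lt_succ θ)) r3).congr_left hwβ.symm⟩
      · exact ⟨r2, hr2, (forcesMem_ord (lt_succ θ) r2).congr_left (forcesEq.trans h hx2).symm⟩
  · refine isFunction_graph (fun i => forcesMem_ord (Ordinal.ToType.mk.symm i).2 _)
      (fun i => forcesMem_check_of_mem (hBmem i) _) (fun y r _ hy => ?_) fun i j hij => ?_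
    · obtain ⟨r', hr', β, hβ, hyβ⟩ := forcesMem_ord_iff.1 hy r le_rfl
      exact ⟨r', hr', Ordinal.ToType.mk ⟨β, hβ⟩, by simpa [A] using hyβ⟩
    · rw [Ordinal.ToType.mk.symm.injective (Subtype.ext (equiv_toPSet_iff.1 hij))]
  · intro y r _ hy r1 hr1
    obtain ⟨r2, hr2, _, ⟨i, hi, rfl⟩, hyi⟩ := forcesMem_subset_iff.1 hy r1 hr1
    have hi' : i < succ θ := lt_succ_iff.2 hi
    refine ⟨r2, hr2, PName.ord P i, forcesMem_ord hi' r2, maps_graph_iff.2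
      fun r3 hr3 => ⟨r3, le_rfl, Ordinal.ToType.mk ⟨i, hi'⟩, ?_, ?_⟩⟩
    · simpa [A] using forcesEq.refl _ r3
    · simpa [B] using hyi.mono hr3
  · intro y y' z z' r1 _ hyz r2 h12 hyz' r3 h23 hyy'
    refine forcesMem.of_dense fun r4 h34 => ?_
    obtain ⟨r5, h45, i, hyi, hzi⟩ := maps_graph_iff.1 hyz r4 (h12.trans (h23.trans h34))
    obtain ⟨r6, h56, j, hyj, hzj⟩ := maps_graph_iff.1 hyz' r5 (h23.trans (h34.trans h45))
    refine ⟨r6, h45.trans h56, ?_⟩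
    have hij := lt_of_forcesMem_ord (((forcesMem.mono hyy' (h34.trans (h45.trans h56))).congr_left
      (hyi.mono h56)).congr_right hyj)
    exact ((forcesMem_ord (hs _ _ hij (hle j)) r6).congr_left (hzi.mono h56).symm).congr_right hzj.symm

end ForcingStatement

/-! ### Fatness in the extension -/

open PName ForcingStatement

/-- Take the least `i` with `β ≤ s i`. If `i` is zero or a successor, a gap of the sequence lies
just below `β`; at a limit `i`, continuity gives `s i = β`. -/
theorem isClosed_image_Iic {lam : Cardinal.{u}} {θ : Ordinal.{u}} {s : Ordinal.{u} → Set.Iio lam.ord}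
    (hs : ∀ i j, i < j → j ≤ θ → s i < s j)
    (hlub : ∀ j ≤ θ, IsSuccLimit j → IsLUB (s '' Set.Iio j) (s j)) (β : Set.Iio lam.ord)
    (h0 : (0 : Ordinal.{u}) < β.1) (hβ : ∀ γ < β, ∃ d ∈ s '' Set.Iic θ, γ < d ∧ d < β) :
    β ∈ s '' Set.Iic θ := by
  have hmono : ∀ i j, i ≤ j → j ≤ θ → s i ≤ s j := fun i j hij hj => by
    rcases hij.lt_or_eq with h | rfl
    · exact (hs _ _ h hj).le
    · exact le_rfl
  have hne : {i | i ≤ θ ∧ β ≤ s i}.Nonempty := by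
    refine ⟨θ, le_rfl, le_of_not_gt fun h => ?_⟩
    obtain ⟨_, ⟨k, hk, rfl⟩, h1, -⟩ := hβ _ h
    exact (hmono k θ hk le_rfl).not_gt h1
  obtain ⟨⟨hi, hβi⟩, hmin⟩ : IsLeast {i | i ≤ θ ∧ β ≤ s i} (sInf {i | i ≤ θ ∧ β ≤ s i}) :=
    isLeast_csInf hne
  set i := sInf {i | i ≤ θ ∧ β ≤ s i}
  have hlt : ∀ k < i, s k < β := fun k hk => lt_of_not_ge fun h => (hmin ⟨hk.le.trans hi, h⟩).not_gt hk
  refine ⟨i, hi, le_antisymm (le_of_not_gt fun h => ?_) hβi⟩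
  rcases Ordinal.zero_or_succ_or_isSuccLimit i with h' | ⟨k, h'⟩ | h'
  · obtain ⟨_, ⟨k, hk, rfl⟩, -, h2⟩ := hβ ⟨0, h0.trans β.2⟩ h0
    exact h2.not_ge (hβi.trans (hmono i k (h' ▸ zero_le) hk))
  · obtain ⟨_, ⟨l, hl, rfl⟩, h1, h2⟩ := hβ (s k) (hlt k ((lt_add_one k).trans_eq h'))
    have hkl : k < l := lt_of_not_ge fun h => (hmono l k h
      ((lt_add_one k).le.trans (h'.trans_le hi))).not_gt h1
    exact h2.not_ge (hβi.trans (hmono i l (h'.ge.trans (add_one_le_of_lt hkl)) hl))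
  · exact h.not_ge ((hlub i hi h').2 (by rintro _ ⟨k, hk, rfl⟩; exact (hlt k hk).le))

theorem IsStrategicallyClosed.isFatInExtension {lam : Cardinal.{u}} (hreg : lam.IsRegular)
    (hunc : ℵ₀ < lam) (hGCH : GCHBelow lam) {S : Set (Set.Iio lam.ord)} (hS : IsFat S)
    {P : Type u} [Preorder P] (hP : IsStrategicallyClosed S P) : IsFatInExtension S P := by
  intro p0
  refine ⟨fun x q hq hx => ?_, fun x p1 _ hx p2 hp2 hxr C p3 hp3 hC p4 hp4 => ?_⟩
  · refine forcesMem_ord_iff.2 fun q' hq' => ?_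
    obtain ⟨r, hr, α, hα, hxα⟩ := forcesMem_subset_iff.1 hx q' hq'
    exact ⟨r, hr, α.1, α.2, hxα⟩
  obtain ⟨p, hp, α, hα, hxα⟩ := forcesMem_ord_iff.1 hx p4 (hp2.trans (hp3.trans hp4))
  obtain ⟨θ, hθ, rfl⟩ : ∃ θ : Cardinal.{u}, θ.IsRegular ∧ α = θ.ord := by
    exact exists_isRegular_of_isRegular hxα (isRegular.mono hxr (hp3.trans (hp4.trans hp)))
  have hθl : θ < lam := ord_lt_ord.1 hα
  replace hC : ∀ q, p ≤ q → isClub C (PName.ord P lam.ord) q :=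
    fun q hq => isClub.mono hC (hp4.trans (hp.trans hq))
  -- At a limit step the ordinal is a supremum of points already forced into `C`, and `C` is forced
  -- to be closed.
  have hlimit : ∀ {θ' : Cardinal.{u}} {q : Ordinal.{u} → P} {s : Ordinal.{u} → Set.Iio lam.ord},
      (∀ j ≤ θ'.ord, p ≤ q j) → (∀ i j, i < j → j ≤ θ'.ord → q i ≤ q j ∧ s i < s j) →
      (∀ j ≤ θ'.ord, IsSuccLimit j → s j ∈ S ∧ IsLUB (s '' Set.Iio j) (s j)) →
      (∀ j < θ'.ord, ¬ IsSuccLimit j → forcesMem (PName.ord P (s j).1) C (q j)) →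
      ∀ j ≤ θ'.ord, IsSuccLimit j → forcesMem (PName.ord P (s j).1) C (q j) := by
    intro θ' q s h0 h1 h2 h3 j hj hl
    refine (hC p le_rfl).mem_of_unbounded (h0 j hj) (s j).2
      (lt_of_le_of_lt zero_le (h1 0 j hl.bot_lt hj).2) fun γ hγ => ?_
    obtain ⟨_, ⟨k, hk, rfl⟩, hγk⟩ := (lt_isLUB_iff (h2 j hj hl).2).1
      (show (⟨γ, hγ.trans (s j).2⟩ : Set.Iio lam.ord) < s j from hγ)
    have hk' : succ k < j := hl.succ_lt hk
    refine ⟨(s (succ k)).1, ?_, (h1 _ _ hk' hj).2, ?_⟩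
    · exact lt_trans (show γ < (s k).1 from hγk) (h1 k (succ k) (lt_succ k) (hk'.le.trans hj)).2
    · exact (h3 _ (hk'.trans_le hj) fun h => h.succ_ne _ rfl).mono (h1 _ _ hk' hj).1
  -- The final set must lie in `S` at non-limit steps too, where the game gives no such guarantee. A
  -- run of length `ω` that decides points of `C` has its limit in both `S` and `C`; such limits
  -- serve as the non-limit steps of the run of length `θ`.
  have hstat : ∀ q γ, p ≤ q → ∃ r s, q ≤ r ∧ γ < s ∧ s ∈ S ∧ forcesMem (PName.ord P s.1) C r := by
    intro q0 γ0 hq0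
    obtain ⟨q, s, h0, h1, h2, h3⟩ := hP.exists_sequence hreg hunc hGCH hS isRegular_aleph0 hunc q0
      (fun _ r s => γ0 < s ∧ forcesMem (PName.ord P s.1) C r) fun _ q γ hq => by
        obtain ⟨r, hr, β, hγβ, hβ, hβC⟩ := (hC q (hq0.trans hq)).exists_mem le_rfl (max γ γ0).2
        exact ⟨r, ⟨β, hβ⟩, hr, (le_max_left γ γ0).trans_lt hγβ, (le_max_right γ γ0).trans_lt hγβ, hβC⟩
    have hl : IsSuccLimit (ℵ₀ : Cardinal.{u}).ord := isSuccLimit_ord le_rfl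
    refine ⟨q (ℵ₀ : Cardinal.{u}).ord, s (ℵ₀ : Cardinal.{u}).ord, h0 _ le_rfl, ?_,
      (h2 _ le_rfl hl).1, ?_⟩
    · exact (h3 0 hl.bot_lt (fun h => h.ne_bot rfl)).1.trans (h1 _ _ hl.bot_lt le_rfl).2
    · exact hlimit (fun j hj => hq0.trans (h0 j hj)) h1 h2
        (fun j hj hjl => (h3 j hj hjl).2) _ le_rfl hl
  obtain ⟨q, s, h0, h1, h2, h3⟩ := hP.exists_sequence hreg hunc hGCH hS hθ hθl p
    (fun _ r s => s ∈ S ∧ forcesMem (PName.ord P s.1) C r) fun _ q γ hq => hstat q γ hq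
  have hs : ∀ i j, i < j → j ≤ θ.ord → s i < s j := fun i j hij hj => (h1 i j hij hj).2
  have hmem : ∀ j ≤ θ.ord, s j ∈ S ∧ forcesMem (PName.ord P (s j).1) C (q θ.ord) := by
    intro j hj
    have hj' : s j ∈ S ∧ forcesMem (PName.ord P (s j).1) C (q j) := by
      by_cases hl : IsSuccLimit j
      · exact ⟨(h2 j hj hl).1, hlimit h0 h1 h2 (fun i hi hil => (h3 i hi hil).2) j hj hl⟩
      · exact h3 j (hj.lt_of_ne fun h => hl (h ▸ isSuccLimit_ord hθ.aleph0_le)) hl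
    refine ⟨hj'.1, ?_⟩
    rcases hj.lt_or_eq with h | rfl
    · exact hj'.2.mono (h1 _ _ h le_rfl).1
    · exact hj'.2
  have hpq : p ≤ q θ.ord := h0 _ le_rfl
  refine ⟨q θ.ord, hp.trans hpq, check (subsetToPSet (s '' Set.Iic θ.ord)), ?_, ?_, ?_, ?_⟩
  · intro y r _ hy
    refine forcesMem_subset_iff.2 fun r1 hr1 => ?_
    obtain ⟨r2, hr2, _, ⟨i, hi, rfl⟩, hyi⟩ := forcesMem_subset_iff.1 hy r1 hr1
    exact ⟨r2, hr2, _, (hmem i hi).1, hyi⟩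
  · intro y r hr hy
    refine forcesMem.of_dense fun r1 hr1 => ?_
    obtain ⟨r2, hr2, _, ⟨i, hi, rfl⟩, hyi⟩ := forcesMem_subset_iff.1 hy r1 hr1
    exact ⟨r2, hr2, ((hmem i hi).2.mono (hr.trans (hr1.trans hr2))).congr_left hyi.symm⟩
  · exact isClosedIn_check
      (isClosed_image_Iic hs fun j hj hl => (h2 j hj hl).2) _
  · exact hasOrderTypeSucc_check hs (hxα.mono hpq)

theorem mainTheorem8 (lam : Cardinal.{u}) (hreg : lam.IsRegular) (hunc : ℵ₀ < lam)
    (hGCH : GCHBelow lam) (S : Set (Set.Iio lam.ord)) (hS : IsFat S)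
    (P : Type u) [Preorder P] :
    (IsExplicitlyClosed S P → IsDistributiveBelow lam P ∧ IsFatInExtension S P) ∧
    (IsStrategicallyClosed S P → IsDistributiveBelow lam P ∧ IsFatInExtension S P) := by
  have hstrat : IsStrategicallyClosed S P → IsDistributiveBelow lam P ∧ IsFatInExtension S P :=
    fun h => ⟨h.isDistributiveBelow hreg hunc hGCH hS, h.isFatInExtension hreg hunc hGCH hS⟩
  refine ⟨fun h => ?_, hstrat⟩
  -- A strategy must assign a move to every history, so the reduction needs a condition; for empty
  -- `P` both conclusions are vacuous.
  rcases isEmpty_or_nonempty P with hP | hP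
  · exact ⟨fun _ _ _ _ p => hP.elim p, fun p => hP.elim p⟩
  · exact hstrat (h.isStrategicallyClosed hreg)
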